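/- Functions on the circle $\mathbb S^1=\mathbb R/\mathbb Z$ are regarded as functions on $\mathbb R$ of period $1$, and $\int$ denotes the integral over one period. Let $(B^1,B^0)$ be either $(C^1(\mathbb S^1),C^0(\mathbb S^1))$ or $(H^1(\mathbb S^1),L^2(\mathbb S^1))$, where $H^1(\mathbb S^1)$ consists of the periodic absolutely continuous real functions with derivative in $L^2$. Let $f:\mathbb R\to\mathbb R$ be smooth, and let $F,\hat F:B^1\to B^0$ be $$F(u)(t)=u'(t)+f(u(t)),\qquad \hat F(u)(t)=u'(t)+\int f(u(s))\,ds .$$ Critical strata. For $G\in\{F,\hat F\}$ let $\Psi_G:B^1\to B^0$, $\Psi_G(u)=G(u)-\int G(u)+\int u$ (this map is bijective), and let $\phi_G(p)=\int G(\Psi_G^{-1}(p))$ for $p\in B^0$, so that in the coordinates $p=\Psi_G(u)=\tilde v+\bar u$ (with $\tilde v$ of mean zero and $\bar u$ constant) the operator $G$ becomes $(\tilde v,\bar u)\mapsto(\tilde v,\phi_G(\tilde v+\bar u))$. For $k\in\mathbb N$ the $k$-th critical stratum of $G$ is $$\Big\{u\in B^1 \;\Big|\; \frac{d^i}{ds^i}\Big|_{s=0}\phi_G(\Psi_G(u)+s)=0,\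 i=1,\dots,k\Big\},$$ where $s$ stands for the constant function. Write $S_k$ for the $k$-th critical stratum of $F$ and $\hat S_k$ for that of $\hat F$; the latter is the set of those $u\in B^1$ with $\int f^{(i)}(u(t))\,dt=0$ for $i=1,\dots,k$. Let $\hat\gamma_k:\mathbb R\to\mathbb R^k$, $\hat\gamma_k(x)=(f'(x),\dots,f^{(k)}(x))$. The function $f$ is called $k$-good if $\hat\gamma_k$ never vanishes and the image under $\hat\gamma_k$ of any nonempty open interval is not contained in a hyperplane through the origin of $\mathbb R^k$. **Lemma.** Let $f$ be smooth and $k$-good. Then, in each of the two cases for $(B^1,B^0)$, 1. $\hat S_k\neq\varnothing$ if and only if $0\in\mathbb R^k$ is in the interior of the convex hull of the image of $\hat\gamma_k$; 2. if $\hat S_k\neq\varnothing$, then $S_k\neq\varnothing$. -/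

import Mathlib

open Set MeasureTheory
open scoped ContDiff

namespace PeriodicODE

noncomputable section

/-! Functions on the circle `ℝ / ℤ` are written as `1`-periodic functions on `ℝ`,
and integrals over the circle as integrals over `(0, 1]`. -/

/-! ### Critical strata of an operator through global adapted coordinates -/

section Strata

variable {B₁ B₀ : Type*} [Nonempty B₁] [AddCommGroup B₀] [Module ℝ B₀]

/-- `Ψ(u) = (G(u) - mean of G(u)) + mean of u`: the map from `B₁` to `B₀` which brings `G` to
adapted coordinates.  Here `m₁`, `m₀` are the mean values on `B₁`, `B₀` and `e` is the constant
function `1` in `B₀`. -/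
def adaptedMap (m₁ : B₁ → ℝ) (m₀ : B₀ → ℝ) (e : B₀) (G : B₁ → B₀) (u : B₁) : B₀ :=
  (G u - m₀ (G u) • e) + m₁ u • e

/-- The height `φ`, that is the mean of `G ∘ Ψ⁻¹`, so that in the coordinates
`B₀ = {mean zero} ⊕ ⟨1⟩` the map `G ∘ Ψ⁻¹` is `(ṽ, ū) ↦ (ṽ, φ(ṽ, ū))`. -/
def height (m₁ : B₁ → ℝ) (m₀ : B₀ → ℝ) (e : B₀) (G : B₁ → B₀) (p : B₀) : ℝ :=
  m₀ (G (Function.invFun (adaptedMap m₁ m₀ e G) p))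

/-- The `k`-th critical stratum of `G`: the points `u` at which the first `k` derivatives of `φ` in
the direction of the constant functions vanish at `Ψ(u)`. -/
def stratum (m₁ : B₁ → ℝ) (m₀ : B₀ → ℝ) (e : B₀) (G : B₁ → B₀) (k : ℕ) : Set B₁ :=
  {u | ∀ i : ℕ, 1 ≤ i → i ≤ k →
    iteratedDeriv i
      (fun s : ℝ => height m₁ m₀ e G (adaptedMap m₁ m₀ e G u + s • e)) 0 = 0}

end Strata

/-! ### The spaces of continuous functions -/

/-- `C¹` of the circle. -/
def C1 : Type := {u : ℝ → ℝ // Function.Periodic u 1 ∧ ContDiff ℝ 1 u}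

instance : Nonempty C1 := ⟨⟨fun _ => 0, fun _ => rfl, contDiff_const⟩⟩

/-- `C⁰` of the circle. -/
def C0 : Submodule ℝ (ℝ → ℝ) where
  carrier := {v | Function.Periodic v 1 ∧ Continuous v}
  add_mem' := fun ha hb => ⟨ha.1.add hb.1, ha.2.add hb.2⟩
  zero_mem' := ⟨fun _ => rfl, continuous_const⟩
  smul_mem' := fun c _ hv => ⟨hv.1.smul c, hv.2.const_smul c⟩

def meanC1 (u : C1) : ℝ := ∫ t in (0 : ℝ)..1, u.1 t

def meanC0 (v : C0) : ℝ := ∫ t in (0 : ℝ)..1, v.1 t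

def oneC0 : C0 := ⟨fun _ => 1, fun _ => rfl, continuous_const⟩

lemma C1.periodic_deriv (u : C1) : Function.Periodic (deriv u.1) 1 := fun t => by
  rw [← deriv_comp_add_const, funext u.2.1]

/-- `F(u)(t) = u'(t) + f(u(t))` from `C¹` to `C⁰`. -/
def opC (f : ℝ → ℝ) (hf : ContDiff ℝ ∞ f) (u : C1) : C0 :=
  ⟨fun t => deriv u.1 t + f (u.1 t),
    fun t => by
      change deriv u.1 (t + 1) + f (u.1 (t + 1)) = deriv u.1 t + f (u.1 t)
      rw [u.periodic_deriv t, u.2.1 t],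
    (u.2.2.continuous_deriv le_rfl).add (hf.continuous.comp u.2.2.continuous)⟩

/-- The simplified operator, `F̂(u)(t) = u'(t) + ∫ f(u(s)) ds`, from `C¹` to `C⁰`. -/
def simpleOpC (f : ℝ → ℝ) (u : C1) : C0 :=
  ⟨fun t => deriv u.1 t + ∫ s in (0 : ℝ)..1, f (u.1 s),
    fun t => by
      change deriv u.1 (t + 1) + _ = deriv u.1 t + _
      rw [u.periodic_deriv t],
    (u.2.2.continuous_deriv le_rfl).add continuous_const⟩

/-- `S_k` in the `C` case. -/
def strataC (f : ℝ → ℝ) (hf : ContDiff ℝ ∞ f) (k : ℕ) : Set C1 :=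
  stratum meanC1 meanC0 oneC0 (opC f hf) k

/-- `Ŝ_k` in the `C` case. -/
def simpleStrataC (f : ℝ → ℝ) (k : ℕ) : Set C1 :=
  stratum meanC1 meanC0 oneC0 (simpleOpC f) k

/-! ### The Sobolev spaces -/

/-- Lebesgue measure on a period. -/
abbrev periodMeasure : Measure ℝ := volume.restrict (Ioc (0 : ℝ) 1)

/-- `H¹` of the circle: the periodic absolutely continuous functions with derivative in `L²`. -/
def H1 : Type :=
  {u : ℝ → ℝ // Function.Periodic u 1 ∧ (∀ a b : ℝ, AbsolutelyContinuousOnInterval u a b) ∧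
    MemLp (deriv u) 2 periodMeasure}

lemma H1.continuous (u : H1) : Continuous u.1 := by
  rw [continuous_iff_continuousAt]
  intro x
  have h := (u.2.2.1 (x - 1) (x + 1)).continuousOn
  rw [uIcc_of_le (by linarith)] at h
  exact h.continuousAt (Icc_mem_nhds (by linarith) (by linarith))

lemma memLp_of_continuous {g : ℝ → ℝ} (hg : Continuous g) : MemLp g 2 periodMeasure := by
  obtain ⟨C, hC⟩ := (isCompact_Icc (a := (0 : ℝ)) (b := 1)).exists_bound_of_continuousOn
    hg.continuousOn
  refine MemLp.of_bound hg.aestronglyMeasurable C ?_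
  filter_upwards [ae_restrict_mem measurableSet_Ioc] with x hx
  exact hC x (Ioc_subset_Icc_self hx)

instance : Nonempty H1 :=
  ⟨⟨fun _ => 0, fun _ => rfl,
    fun a b => by
      simpa using (LipschitzOnWith.of_dist_le_mul (K := 0) (s := uIcc a b)
        (f := fun _ : ℝ => (0 : ℝ)) (by simp)).absolutelyContinuousOnInterval,
    by simp⟩⟩

/-- `L²` of the circle. -/
abbrev H0 : Type := Lp ℝ 2 periodMeasure

def meanH1 (u : H1) : ℝ := ∫ t in (0 : ℝ)..1, u.1 t

def meanH0 (v : H0) : ℝ := ∫ t in (0 : ℝ)..1, v t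

def oneH0 : H0 := (memLp_of_continuous (continuous_const (y := (1 : ℝ)))).toLp _

/-- `F(u) = u' + f(u)` from `H¹` to `L²`. -/
def opH (f : ℝ → ℝ) (hf : ContDiff ℝ ∞ f) (u : H1) : H0 :=
  (u.2.2.2.add (memLp_of_continuous (hf.continuous.comp u.continuous))).toLp
    (fun t => deriv u.1 t + f (u.1 t))

/-- The simplified operator, `F̂(u) = u' + ∫ f(u(s)) ds`, from `H¹` to `L²`. -/
def simpleOpH (f : ℝ → ℝ) (u : H1) : H0 :=
  (u.2.2.2.add (memLp_of_continuous
      (continuous_const (y := ∫ s in (0 : ℝ)..1, f (u.1 s))))).toLp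
    (fun t => deriv u.1 t + ∫ s in (0 : ℝ)..1, f (u.1 s))

/-- `S_k` in the `H` case. -/
def strataH (f : ℝ → ℝ) (hf : ContDiff ℝ ∞ f) (k : ℕ) : Set H1 :=
  stratum meanH1 meanH0 oneH0 (opH f hf) k

/-- `Ŝ_k` in the `H` case. -/
def simpleStrataH (f : ℝ → ℝ) (k : ℕ) : Set H1 :=
  stratum meanH1 meanH0 oneH0 (simpleOpH f) k

/-! ### The curve `γ̂_k` and `k`-good functions -/

/-- `γ̂_k(x) = (f'(x), …, f^{(k)}(x))`. -/
def gammaHat (f : ℝ → ℝ) (k : ℕ) (x : ℝ) : Fin k → ℝ :=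
  fun i => iteratedDeriv (i.1 + 1) f x

/-- `γ̂_k` never vanishes, and it maps no nonempty open interval into a hyperplane through the
origin of `ℝᵏ`. -/
def IsGood (f : ℝ → ℝ) (k : ℕ) : Prop :=
  (∀ x, gammaHat f k x ≠ 0) ∧
    ∀ a b : ℝ, a < b → ∀ P : Submodule ℝ (Fin k → ℝ), Module.finrank ℝ P + 1 = k →
      ¬ gammaHat f k '' Ioo a b ⊆ P

end

end PeriodicODE

/-! If a family `U s` with `U 0 = u` satisfies `mean (U s) = mean u + s` and `G (U s) = G u + β s`
with `β s` constant in time, then `Ψ (U s) = Ψ u + s`, so the height along the fibre through `u` is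
`β` up to an additive constant. Hence `u` lies in the `k`-th stratum iff the first `k` derivatives
of `β` vanish at `0` (`mem_stratum_iff`). Only injectivity of `Ψ` is needed, and it follows from
uniqueness for a scalar linear periodic equation. For the simplified operator `U s = u + s` works,
which gives the description of its strata by `∫ f^{(i)}(u) = 0`.

Everything then rests on the linear map `moment`, sending a weight `ρ` to the means of `ρ
f^{(i)}(v)`. For nonconstant `v`, goodness makes it surjective (`moment_surjective`). A positive
weight of mean `1` amounts to a change of parameter of the circle (`exists_reparametrization`).

Part 1. If `v` lies in the simplified stratum, the weights near `1` have moments filling a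
neighbourhood of `0`, and these moments are averages of `γ̂_k`; so `0` is interior to the hull.
Conversely, if no positive weight on any `R sin(2πt)` had zero moment, separating functionals of
norm `1` would accumulate at one that is nonpositive on the whole hull. A weight with zero moment,
used as a change of parameter, gives a point of the simplified stratum.

Part 2. Given `v` in the simplified stratum, run through it quickly: try `U s = (v + z_s)(θ(nt))`
with `θ' = 1/ρ(θ)`. With `ε = 1/n`, the requirement on `U s` becomes `z' = -ε ρ (f(v + z) - f(v) -
b)` with `ρ z` of mean `s`. At `ε = 0` the solution is the constant `s`, and the derivatives of `b`
at `s = 0` are the moments of `ρ`. Since the moment map is surjective, `ρ` can be corrected for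
small `ε` so that the first `k` derivatives of `b` still vanish (`exists_flat_family`). The work
takes place in continuous functions on the circle; the equation supplies the regularity, so one
family serves both pairs of spaces. -/

namespace PeriodicODE

open Filter Topology

/-! ### The Banach algebra of continuous functions on the circle -/

/-- The Banach algebra of continuous functions on the circle. -/
abbrev CircleFun : Type := C(UnitAddCircle, ℝ)

namespace CircleFun

/-- The continuous function on the circle defined by a continuous periodic function. -/
def ofPeriodic (u : ℝ → ℝ) (hp : Function.Periodic u 1) (hc : Continuous u) : CircleFun where
  toFun := hp.lift
  continuous_toFun := hc.quotient_lift _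

@[simp] lemma ofPeriodic_coe (u : ℝ → ℝ) (hp : Function.Periodic u 1) (hc : Continuous u) (t : ℝ) :
    ofPeriodic u hp hc (t : UnitAddCircle) = u t := rfl

lemma continuous_coe (h : CircleFun) : Continuous fun t : ℝ => h (t : UnitAddCircle) :=
  h.continuous.comp (AddCircle.continuous_mk' 1)

lemma periodic_coe (h : CircleFun) : Function.Periodic (fun t : ℝ => h (t : UnitAddCircle)) 1 :=
  fun t => by
    have := AddCircle.coe_add_period (1 : ℝ) t
    simp only [this]

lemma ext_coe {g h : CircleFun} (H : ∀ t : ℝ, g (t : UnitAddCircle) = h (t : UnitAddCircle)) :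
    g = h := by
  ext x
  induction x using QuotientAddGroup.induction_on with
  | H t => exact H t

lemma abs_apply_le (h : CircleFun) (x : UnitAddCircle) : |h x| ≤ ‖h‖ := h.norm_coe_le_norm x

/-- The mean value. -/
noncomputable def mean : CircleFun →L[ℝ] ℝ :=
  LinearMap.mkContinuous
    { toFun := fun h => ∫ t in (0 : ℝ)..1, h (t : UnitAddCircle)
      map_add' := fun g h => intervalIntegral.integral_add
        (g.continuous_coe.intervalIntegrable _ _) (h.continuous_coe.intervalIntegrable _ _)
      map_smul' := fun c h => intervalIntegral.integral_const_mul c _ } 1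
    (fun h => by
      have := intervalIntegral.norm_integral_le_of_norm_le_const (a := (0 : ℝ)) (b := 1)
        (f := fun t : ℝ => h (t : UnitAddCircle)) (C := ‖h‖) (fun t _ => h.norm_coe_le_norm _)
      simpa using this)

lemma mean_apply (h : CircleFun) : mean h = ∫ t in (0 : ℝ)..1, h (t : UnitAddCircle) := rfl

@[simp] lemma mean_one : mean (1 : CircleFun) = 1 := by simp [mean_apply]

lemma mean_pos {h : CircleFun} (hh : ∀ x, 0 < h x) : 0 < mean h :=
  intervalIntegral.intervalIntegral_pos_of_pos (h.continuous_coe.intervalIntegrable _ _)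
    (fun t => hh t) one_pos

lemma eq_zero_of_mean_sq {h : CircleFun} (hh : mean (h * h) = 0) : h = 0 := by
  have h1 : Continuous fun t : ℝ => (h * h) (t : UnitAddCircle) := (h * h).continuous_coe
  by_contra hne
  obtain ⟨x, hx⟩ : ∃ x, h x ≠ 0 := by
    by_contra! H
    exact hne (ContinuousMap.ext H)
  obtain ⟨t, ht, rfl⟩ : ∃ t ∈ Ico (0 : ℝ) 1, (t : UnitAddCircle) = x := by
    have := AddCircle.coe_image_Ico_eq (1 : ℝ) 0
    have hx' : x ∈ ((↑) : ℝ → UnitAddCircle) '' Ico (0 : ℝ) (0 + 1) := by rw [this]; trivial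
    obtain ⟨t, ht, e⟩ := hx'
    exact ⟨t, by simpa using ht, e⟩
  have : 0 < ∫ t in (0 : ℝ)..1, (h * h) (t : UnitAddCircle) :=
    intervalIntegral.integral_pos one_pos h1.continuousOn
      (fun s _ => mul_self_nonneg (h s)) ⟨t, ⟨ht.1, ht.2.le⟩, mul_self_pos.2 hx⟩
  rw [mean_apply] at hh
  exact this.ne' hh

/-- The periodic primitive of `h - mean h` which vanishes at `0`. -/
noncomputable def primitive : CircleFun →L[ℝ] CircleFun :=
  LinearMap.mkContinuous
    { toFun := fun h => ofPeriodic (fun x => (∫ t in (0 : ℝ)..x, h (t : UnitAddCircle)) - x * mean h)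
        (fun x => by
          have h1 := h.periodic_coe.intervalIntegral_add_eq_add 0 x
            (fun a b => h.continuous_coe.intervalIntegrable a b)
          simp only [zero_add] at h1
          simp only [h1, mean_apply]
          ring)
        ((intervalIntegral.continuous_primitive
          (fun a b => h.continuous_coe.intervalIntegrable a b) 0).sub
            (continuous_id.mul continuous_const))
      map_add' := fun g h => ext_coe fun x => by
        have := intervalIntegral.integral_add (μ := volume)
          (g.continuous_coe.intervalIntegrable 0 x) (h.continuous_coe.intervalIntegrable 0 x)
        change (∫ t in (0 : ℝ)..x, (g (t : UnitAddCircle) + h (t : UnitAddCircle))) - x * mean (g + h) =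
          ((∫ t in (0 : ℝ)..x, g (t : UnitAddCircle)) - x * mean g) +
            ((∫ t in (0 : ℝ)..x, h (t : UnitAddCircle)) - x * mean h)
        rw [this, map_add]
        ring
      map_smul' := fun c h => ext_coe fun x => by
        change (∫ t in (0 : ℝ)..x, c * h (t : UnitAddCircle)) - x * mean (c • h) =
          c * ((∫ t in (0 : ℝ)..x, h (t : UnitAddCircle)) - x * mean h)
        rw [intervalIntegral.integral_const_mul, map_smul, smul_eq_mul]
        ring } 2
    (fun h => by
      refine (ContinuousMap.norm_le _ (by positivity)).2 fun x => ?_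
      obtain ⟨t, ht, rfl⟩ : ∃ t ∈ Ico (0 : ℝ) 1, (t : UnitAddCircle) = x := by
        have := AddCircle.coe_image_Ico_eq (1 : ℝ) 0
        have hx' : x ∈ ((↑) : ℝ → UnitAddCircle) '' Ico (0 : ℝ) (0 + 1) := by rw [this]; trivial
        obtain ⟨t, ht, e⟩ := hx'
        exact ⟨t, by simpa using ht, e⟩
      have key : ∀ s ∈ Icc (0 : ℝ) 1, |∫ r in (0 : ℝ)..s, h (r : UnitAddCircle)| ≤ ‖h‖ := by
        intro s hs
        have := intervalIntegral.norm_integral_le_of_norm_le_const (a := (0 : ℝ)) (b := s)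
          (f := fun t : ℝ => h (t : UnitAddCircle)) (C := ‖h‖) (fun t _ => h.norm_coe_le_norm _)
        rw [sub_zero, abs_of_nonneg hs.1, Real.norm_eq_abs] at this
        exact this.trans (mul_le_of_le_one_right (norm_nonneg _) hs.2)
      have k1 := key t ⟨ht.1, ht.2.le⟩
      have k2 := key 1 ⟨zero_le_one, le_rfl⟩
      change |(∫ r in (0 : ℝ)..t, h (r : UnitAddCircle)) - t * mean h| ≤ _
      refine (abs_sub _ _).trans ?_
      have k3 : |t * mean h| ≤ ‖h‖ := by
        rw [abs_mul, abs_of_nonneg ht.1]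
        exact (mul_le_of_le_one_left (abs_nonneg _) ht.2.le).trans k2
      linarith)

lemma primitive_coe (h : CircleFun) (x : ℝ) :
    primitive h (x : UnitAddCircle) = (∫ t in (0 : ℝ)..x, h (t : UnitAddCircle)) - x * mean h := rfl

lemma primitive_zero (h : CircleFun) : primitive h (0 : UnitAddCircle) = 0 := by
  have := primitive_coe h 0
  simpa using this

lemma hasDerivAt_primitive (h : CircleFun) (x : ℝ) :
    HasDerivAt (fun x : ℝ => primitive h (x : UnitAddCircle)) (h (x : UnitAddCircle) - mean h) x := by
  have h1 := intervalIntegral.integral_hasDerivAt_right (h.continuous_coe.intervalIntegrable 0 x)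
    (h.continuous_coe.stronglyMeasurableAtFilter _ _) h.continuous_coe.continuousAt
  have h2 := h1.sub ((hasDerivAt_id x).mul_const (mean h))
  rw [one_mul] at h2
  exact h2

/-! ### Composition operators -/

/-- The operator `u ↦ f ∘ u` of composition with a continuous function `f`. -/
def compOp (f : ℝ → ℝ) (hf : Continuous f) (u : CircleFun) : CircleFun := ContinuousMap.comp ⟨f, hf⟩ u

@[simp] lemma compOp_apply (f : ℝ → ℝ) (hf : Continuous f) (u : CircleFun) (x : UnitAddCircle) :
    compOp f hf u x = f (u x) := rfl

lemma continuous_compOp (f : ℝ → ℝ) (hf : Continuous f) : Continuous (compOp f hf) :=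
  ContinuousMap.continuous_postcomp _

lemma exists_taylor_bound {f : ℝ → ℝ} (hf : ContDiff ℝ 2 f) (R : ℝ) :
    ∃ C : ℝ, 0 ≤ C ∧ ∀ x y, |x| ≤ R → |y| ≤ R → |f y - f x - deriv f x * (y - x)| ≤ C * |y - x| ^ 2 := by
  have hf1 : ContDiff ℝ 1 (deriv f) := by
    have : ContDiff ℝ (1 + 1) f := hf
    exact ((contDiff_succ_iff_deriv).1 this).2.2
  obtain ⟨C, hC⟩ := (isCompact_Icc (a := -R) (b := R)).exists_bound_of_continuousOn
    (hf1.continuous_deriv le_rfl).continuousOn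
  refine ⟨max C 0, le_max_right _ _, fun x y hx hy => ?_⟩
  have hsub : ∀ z ∈ uIcc x y, |z| ≤ R := by
    intro z hz
    rw [abs_le] at *
    rcases le_total x y with h | h
    · rw [uIcc_of_le h] at hz; constructor <;> linarith [hz.1, hz.2]
    · rw [uIcc_of_ge h] at hz; constructor <;> linarith [hz.1, hz.2]
  have hd : ∀ z ∈ uIcc x y, |deriv f z - deriv f x| ≤ max C 0 * |y - x| := by
    intro z hz
    have h1 := (convex_uIcc x y).norm_image_sub_le_of_norm_deriv_le (f := deriv f) (C := max C 0)
      (fun w _ => (hf1.differentiable one_ne_zero).differentiableAt)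
      (fun w hw => (hC w (abs_le.1 (hsub w hw))).trans (le_max_left _ _)) left_mem_uIcc hz
    refine h1.trans (mul_le_mul_of_nonneg_left ?_ (le_max_right _ _))
    rw [Real.norm_eq_abs]
    exact abs_sub_left_of_mem_uIcc hz
  have h2 := (convex_uIcc x y).norm_image_sub_le_of_norm_hasDerivWithin_le
    (f := fun z => f z - deriv f x * z) (f' := fun z => deriv f z - deriv f x)
    (C := max C 0 * |y - x|)
    (fun z _ => (((hf.differentiable two_ne_zero) z).hasDerivAt.sub
      (by simpa using (hasDerivAt_id z).const_mul (deriv f x))).hasDerivWithinAt)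
    (fun z hz => hd z hz) left_mem_uIcc right_mem_uIcc
  rw [Real.norm_eq_abs, Real.norm_eq_abs] at h2
  calc _ = |f y - deriv f x * y - (f x - deriv f x * x)| := by congr 1; ring
    _ ≤ _ := h2
    _ = _ := by ring

lemma hasFDerivAt_compOp {f : ℝ → ℝ} (hf : ContDiff ℝ 2 f) (u : CircleFun) :
    HasFDerivAt (compOp f hf.continuous)
      (ContinuousLinearMap.mul ℝ CircleFun
        (compOp (deriv f) (hf.continuous_deriv one_le_two) u)) u := by
  obtain ⟨C, hC0, hC⟩ := exists_taylor_bound hf (‖u‖ + 1)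
  rw [hasFDerivAt_iff_isLittleO_nhds_zero]
  have hO : (fun h : CircleFun => compOp f hf.continuous (u + h) - compOp f hf.continuous u -
      ContinuousLinearMap.mul ℝ CircleFun (compOp (deriv f) (hf.continuous_deriv one_le_two) u) h)
      =O[𝓝 0] fun h => ‖h‖ ^ 2 := by
    refine Asymptotics.IsBigO.of_bound C ?_
    filter_upwards [Metric.ball_mem_nhds (0 : CircleFun) one_pos] with h hh
    rw [mem_ball_zero_iff] at hh
    refine (ContinuousMap.norm_le _ (by positivity)).2 fun x => ?_
    have hx := hC (u x) (u x + h x) ((u.abs_apply_le x).trans (by linarith))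
      ((abs_add_le _ _).trans (by linarith [u.abs_apply_le x, h.abs_apply_le x]))
    rw [add_sub_cancel_left] at hx
    refine (le_of_eq_of_le rfl hx).trans ?_
    rw [norm_pow, norm_norm]
    exact mul_le_mul_of_nonneg_left (pow_le_pow_left₀ (abs_nonneg _) (h.abs_apply_le x) 2) hC0
  refine hO.trans_isLittleO ?_
  have := Asymptotics.isLittleO_norm_pow_id (E' := CircleFun) one_lt_two
  exact this

/-- The derivative at `u` is multiplication by `f' ∘ u`, that is, a bounded linear map applied to
the composition operator of `f'`; induct on `n` with `f` varying. -/
lemma contDiff_compOp {f : ℝ → ℝ} (hf : ContDiff ℝ ∞ f) (n : ℕ) :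
    ContDiff ℝ n (compOp f hf.continuous) := by
  induction n generalizing f with
  | zero => exact contDiff_zero.2 (continuous_compOp _ _)
  | succ n ih =>
    have hf2 : ContDiff ℝ 2 f := by exact_mod_cast contDiff_infty.1 hf 2
    have hf' : ContDiff ℝ ∞ (deriv f) := (contDiff_infty_iff_deriv.1 hf).2
    refine contDiff_succ_iff_hasFDerivAt.2 ⟨_, ?_, fun u => hasFDerivAt_compOp hf2 u⟩
    have hmul : ContDiff ℝ n fun a : CircleFun => ContinuousLinearMap.mul ℝ CircleFun a :=
      ContinuousLinearMap.contDiff (E := CircleFun) (F := CircleFun →L[ℝ] CircleFun) _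
    exact hmul.comp (ih hf')

end CircleFun

/-! ### Strata along one-parameter families -/

section Strata

variable {B₁ B₀ : Type*} [AddCommGroup B₀] [Module ℝ B₀]
  {m₁ : B₁ → ℝ} {m₀ : B₀ → ℝ} {e : B₀} {G : B₁ → B₀}

lemma mean_adaptedMap (hm : IsLinearMap ℝ m₀) (he : m₀ e = 1) (u : B₁) :
    m₀ (adaptedMap m₁ m₀ e G u) = m₁ u := by
  simp [adaptedMap, hm.map_add, hm.map_sub, hm.map_smul, he]

/-- Equal images under `Ψ` force equal means, and then `G u₁` and `G u₂` differ by a constant. What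
remains is a uniqueness statement for the differential equation. -/
lemma adaptedMap_injective (hm : IsLinearMap ℝ m₀) (he : m₀ e = 1)
    (hG : ∀ (u₁ u₂ : B₁) (c : ℝ), m₁ u₁ = m₁ u₂ → G u₁ = G u₂ + c • e → u₁ = u₂) :
    Function.Injective (adaptedMap m₁ m₀ e G) := by
  intro u₁ u₂ h
  have h1 : m₁ u₁ = m₁ u₂ := by
    rw [← mean_adaptedMap (m₁ := m₁) (G := G) hm he u₁, h, mean_adaptedMap hm he]
  refine hG u₁ u₂ (m₀ (G u₁) - m₀ (G u₂)) h1 ?_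
  unfold adaptedMap at h
  rw [h1] at h
  have h2 := add_right_cancel h
  rw [sub_smul, ← sub_eq_iff_eq_add']
  rw [sub_eq_sub_iff_sub_eq_sub] at h2
  exact h2

/-- The family `U` parametrizes the fibre near `u`: `Ψ (U s) = Ψ u + s • e`. Injectivity makes
`invFun` return `U s` there, so surjectivity of `Ψ` is not required. -/
lemma mem_stratum_iff [Nonempty B₁] (hm : IsLinearMap ℝ m₀) (he : m₀ e = 1)
    (hinj : Function.Injective (adaptedMap m₁ m₀ e G)) {u : B₁} {U : ℝ → B₁} {β : ℝ → ℝ}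
    (hU : ∀ᶠ s in 𝓝 (0 : ℝ), G (U s) = G u + β s • e ∧ m₁ (U s) = m₁ u + s) (k : ℕ) :
    u ∈ stratum m₁ m₀ e G k ↔ ∀ i, 1 ≤ i → i ≤ k → iteratedDeriv i β 0 = 0 := by
  have h1 : (fun s : ℝ => height m₁ m₀ e G (adaptedMap m₁ m₀ e G u + s • e)) =ᶠ[𝓝 0]
      fun s => m₀ (G u) + β s := by
    filter_upwards [hU] with s hs
    have : adaptedMap m₁ m₀ e G u + s • e = adaptedMap m₁ m₀ e G (U s) := by
      simp only [adaptedMap, hs.1, hs.2, hm.map_add, hm.map_smul, he, smul_eq_mul, mul_one]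
      module
    rw [this, height, Function.leftInverse_invFun hinj, hs.1, hm.map_add, hm.map_smul, he]
    simp
  unfold stratum
  change (∀ i : ℕ, _) ↔ _
  refine forall_congr' fun i => forall_congr' fun hi => ?_
  rw [h1.iteratedDeriv_eq i, iteratedDeriv_const_add hi]

end Strata

/-! ### Injectivity of the adapted maps -/

lemma exists_continuous_slope {f : ℝ → ℝ} (hf : ContDiff ℝ 1 f) {u₁ u₂ : ℝ → ℝ}
    (h₁ : Continuous u₁) (h₂ : Continuous u₂) :
    ∃ a : ℝ → ℝ, Continuous a ∧ ∀ t, f (u₁ t) - f (u₂ t) = a t * (u₁ t - u₂ t) := by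
  have hf' : Continuous (deriv f) := hf.continuous_deriv le_rfl
  refine ⟨fun t => ∫ σ in (0 : ℝ)..1, deriv f (u₂ t + σ * (u₁ t - u₂ t)), ?_, fun t => ?_⟩
  · refine intervalIntegral.continuous_parametric_intervalIntegral_of_continuous' ?_ _ _
    exact hf'.comp (by fun_prop)
  · rw [← intervalIntegral.integral_mul_const]
    have := intervalIntegral.integral_eq_sub_of_hasDerivAt (a := (0 : ℝ)) (b := 1)
      (f := fun σ => f (u₂ t + σ * (u₁ t - u₂ t)))
      (f' := fun σ => deriv f (u₂ t + σ * (u₁ t - u₂ t)) * (u₁ t - u₂ t))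
      (fun σ _ => by
        have h := ((hasDerivAt_id σ).mul_const (u₁ t - u₂ t)).const_add (u₂ t)
        rw [one_mul] at h
        exact HasDerivAt.comp σ ((hf.differentiable one_ne_zero) _).hasDerivAt h)
      (Continuous.intervalIntegrable (by fun_prop) _ _)
    rw [this]
    simp

/-- With the integrating factor `E = exp ∫ a`, `(w E)' = c E`. Mean zero gives a zero `t₀` of `w`;
periodicity compares the two sides of `t₀` and forces `c = 0`, after which `w E` is constant and
vanishes at `t₀`. The integrated form of the equation accommodates absolutely continuous functions.
-/
lemma eq_zero_of_linear_equation {w a : ℝ → ℝ} {c : ℝ} (hw : Continuous w) (ha : Continuous a)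
    (hint : ∀ t ∈ Icc (0 : ℝ) 1, w t = w 0 + ∫ s in (0 : ℝ)..t, (c - a s * w s))
    (hper : w 0 = w 1) (hmean : ∫ t in (0 : ℝ)..1, w t = 0) : ∀ t ∈ Icc (0 : ℝ) 1, w t = 0 := by
  have prim : ∀ {g : ℝ → ℝ}, Continuous g → ∀ t, HasDerivAt (fun t => ∫ s in (0 : ℝ)..t, g s) (g t) t :=
    fun hg t => intervalIntegral.integral_hasDerivAt_right (hg.intervalIntegrable _ _)
      (hg.stronglyMeasurableAtFilter _ _) hg.continuousAt
  -- Rolle's theorem for the primitive of `w`, which vanishes at both ends of the period.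
  obtain ⟨t₀, ht₀, hz⟩ := exists_hasDerivAt_eq_zero (f := fun t => ∫ s in (0 : ℝ)..t, w s) (f' := w)
    one_pos (fun t _ => (prim hw t).continuousAt.continuousWithinAt) (by simp [hmean])
    (fun t _ => prim hw t)
  set E : ℝ → ℝ := fun t => Real.exp (∫ s in (0 : ℝ)..t, a s) with hE
  have hE' : ∀ t, HasDerivAt E (E t * a t) t := fun t => (prim ha t).exp
  have hEc : Continuous E := continuous_iff_continuousAt.2 fun t => (hE' t).continuousAt
  have hEpos : ∀ t, 0 < E t := fun t => Real.exp_pos _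
  have hW : ∀ x ∈ Icc (0 : ℝ) 1, ∀ y ∈ Icc (0 : ℝ) 1, w y * E y - w x * E x = c * ∫ s in x..y, E s := by
    intro x hx y hy
    have hsub : uIcc x y ⊆ Icc 0 1 := by
      rw [← uIcc_of_le zero_le_one] at hx hy ⊢
      exact uIcc_subset_uIcc hx hy
    have hd : ∀ t ∈ uIcc x y, HasDerivAt
        (fun t => (w 0 + ∫ s in (0 : ℝ)..t, (c - a s * w s)) * E t) (c * E t) t := by
      intro t ht
      have h := ((prim (g := fun s => c - a s * w s) (by fun_prop) t).const_add (w 0)).mul (hE' t)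
      rw [← hint t (hsub ht)] at h
      convert! h using 1
      ring
    have := intervalIntegral.integral_eq_sub_of_hasDerivAt hd
      (Continuous.intervalIntegrable (by fun_prop) _ _)
    rw [intervalIntegral.integral_const_mul] at this
    rw [this, ← hint x hx, ← hint y hy]
  have h0 := hW 0 (by simp) t₀ ⟨ht₀.1.le, ht₀.2.le⟩
  have h1 := hW t₀ ⟨ht₀.1.le, ht₀.2.le⟩ 1 (by simp)
  rw [hz] at h0 h1
  have p0 : 0 < ∫ s in (0 : ℝ)..t₀, E s :=
    intervalIntegral.intervalIntegral_pos_of_pos (hEc.intervalIntegrable _ _) hEpos ht₀.1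
  have p1 : 0 < ∫ s in t₀..1, E s :=
    intervalIntegral.intervalIntegral_pos_of_pos (hEc.intervalIntegrable _ _) hEpos ht₀.2
  have hc : c = 0 := by
    rw [← hper] at h1
    have h2 : c * ((∫ s in (0 : ℝ)..t₀, E s) * E 1 + (∫ s in t₀..1, E s) * E 0) = 0 := by
      linear_combination -h0 * E 1 - h1 * E 0
    have := add_pos (mul_pos p0 (hEpos 1)) (mul_pos p1 (hEpos 0))
    exact (mul_eq_zero.1 h2).resolve_right this.ne'
  intro t ht
  have h2 := hW t₀ ⟨ht₀.1.le, ht₀.2.le⟩ t ht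
  rw [hz, hc, zero_mul, zero_mul, sub_zero] at h2
  exact (mul_eq_zero.1 h2).resolve_right (hEpos t).ne'

lemma H1.ext_of_equation {f : ℝ → ℝ} (hf : ContDiff ℝ 1 f) {u₁ u₂ : H1} {c : ℝ}
    (hm : meanH1 u₁ = meanH1 u₂)
    (h : ∀ᵐ t ∂periodMeasure, deriv u₁.1 t + f (u₁.1 t) = deriv u₂.1 t + f (u₂.1 t) + c) :
    u₁ = u₂ := by
  obtain ⟨a, ha, hfa⟩ := exists_continuous_slope hf u₁.continuous u₂.continuous
  have key := eq_zero_of_linear_equation (w := fun t => u₁.1 t - u₂.1 t) (c := c)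
    (u₁.continuous.sub u₂.continuous) ha (fun t ht => by
      have i₁ := (u₁.2.2.1 0 t).intervalIntegrable_deriv
      have i₂ := (u₂.2.2.1 0 t).intervalIntegrable_deriv
      have e₁ := (u₁.2.2.1 0 t).integral_deriv_eq_sub
      have e₂ := (u₂.2.2.1 0 t).integral_deriv_eq_sub
      have : ∫ s in (0 : ℝ)..t, (c - a s * (u₁.1 s - u₂.1 s)) =
          ∫ s in (0 : ℝ)..t, (deriv u₁.1 s - deriv u₂.1 s) := by
        refine intervalIntegral.integral_congr_ae ?_
        rw [ae_restrict_iff' measurableSet_Ioc] at h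
        filter_upwards [h] with s hs hst
        rw [uIoc_of_le ht.1] at hst
        rw [← hfa]
        linarith [hs ⟨hst.1, hst.2.trans ht.2⟩]
      rw [this, intervalIntegral.integral_sub i₁ i₂, e₁, e₂]
      ring)
    (by
      have h₁ := u₁.2.1 0
      have h₂ := u₂.2.1 0
      rw [zero_add] at h₁ h₂
      simp only [h₁, h₂])
    (by
      rw [intervalIntegral.integral_sub (u₁.continuous.intervalIntegrable _ _)
        (u₂.continuous.intervalIntegrable _ _)]
      exact sub_eq_zero.2 hm)
  refine Subtype.ext (funext fun t => ?_)
  have hp : Function.Periodic (fun t => u₁.1 t - u₂.1 t) 1 := u₁.2.1.sub u₂.2.1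
  obtain ⟨y, hy, e⟩ := hp.exists_mem_Ico₀ one_pos t
  have := key y ⟨hy.1, hy.2.le⟩
  exact sub_eq_zero.1 (e.trans this)

/-- The inclusion of `C¹` in `H¹`. -/
def C1.toH1 (u : C1) : H1 :=
  ⟨u.1, u.2.1, fun a b => by
    obtain ⟨C, hC⟩ := (isCompact_uIcc (a := a) (b := b)).exists_bound_of_continuousOn
      (u.2.2.continuous_deriv le_rfl).continuousOn
    refine LipschitzOnWith.absolutelyContinuousOnInterval (K := C.toNNReal) ?_
    refine Convex.lipschitzOnWith_of_nnnorm_deriv_le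
      (fun x _ => (u.2.2.differentiable one_ne_zero) x) (fun x hx => ?_) (convex_uIcc a b)
    exact NNReal.le_toNNReal_of_coe_le (hC x hx),
    memLp_of_continuous (u.2.2.continuous_deriv le_rfl)⟩

lemma C1.ext_of_equation {f : ℝ → ℝ} (hf : ContDiff ℝ 1 f) {u₁ u₂ : C1} {c : ℝ}
    (hm : meanC1 u₁ = meanC1 u₂)
    (h : ∀ t, deriv u₁.1 t + f (u₁.1 t) = deriv u₂.1 t + f (u₂.1 t) + c) : u₁ = u₂ := by
  have := H1.ext_of_equation (u₁ := u₁.toH1) (u₂ := u₂.toH1) hf hm (Eventually.of_forall h)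
  exact Subtype.ext (show u₁.toH1.1 = u₂.toH1.1 by rw [this])

lemma isLinearMap_meanC0 : IsLinearMap ℝ meanC0 where
  map_add u v := intervalIntegral.integral_add (u.2.2.intervalIntegrable _ _)
    (v.2.2.intervalIntegrable _ _)
  map_smul c _ := intervalIntegral.integral_const_mul c _

lemma meanC0_one : meanC0 oneC0 = 1 := by simp [meanC0, oneC0]

lemma meanH0_eq (v : H0) : meanH0 v = ∫ t, v t ∂periodMeasure :=
  intervalIntegral.integral_of_le zero_le_one

lemma integrable_H0 (v : H0) : Integrable v periodMeasure :=
  (Lp.memLp v).integrable one_le_two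

lemma isLinearMap_meanH0 : IsLinearMap ℝ meanH0 where
  map_add u v := by
    rw [meanH0_eq, meanH0_eq, meanH0_eq, ← integral_add (integrable_H0 u) (integrable_H0 v)]
    exact integral_congr_ae (Lp.coeFn_add u v)
  map_smul c v := by
    rw [meanH0_eq, meanH0_eq, smul_eq_mul, ← integral_const_mul]
    exact integral_congr_ae (Lp.coeFn_smul c v)

lemma coeFn_oneH0 : oneH0 =ᵐ[periodMeasure] fun _ => (1 : ℝ) := MemLp.coeFn_toLp _

lemma meanH0_one : meanH0 oneH0 = 1 := by
  rw [meanH0_eq, integral_congr_ae coeFn_oneH0]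
  simp

lemma toLp_eq_add_smul_oneH0_iff {g₁ g₂ : ℝ → ℝ} (h₁ : MemLp g₁ 2 periodMeasure)
    (h₂ : MemLp g₂ 2 periodMeasure) (c : ℝ) :
    h₁.toLp g₁ = h₂.toLp g₂ + c • oneH0 ↔ ∀ᵐ t ∂periodMeasure, g₁ t = g₂ t + c := by
  have : h₂.toLp g₂ + c • oneH0 = (h₂.add (memLp_const c)).toLp := by
    rw [MemLp.toLp_add h₂ (memLp_const c), oneH0, ← MemLp.toLp_const_smul]
    congr 1
    exact MemLp.toLp_congr _ _ (Eventually.of_forall fun t => by simp)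
  rw [this, MemLp.toLp_eq_toLp_iff]
  rfl

lemma injective_adaptedMap_opC (f : ℝ → ℝ) (hf : ContDiff ℝ ∞ f) :
    Function.Injective (adaptedMap meanC1 meanC0 oneC0 (opC f hf)) :=
  adaptedMap_injective isLinearMap_meanC0 meanC0_one fun u₁ u₂ c hm h =>
    C1.ext_of_equation (c := c) (contDiff_infty.1 hf 1) hm fun t => by
      have := congrFun (congrArg Subtype.val h) t
      exact this.trans (congrArg _ (mul_one c))

lemma injective_adaptedMap_opH (f : ℝ → ℝ) (hf : ContDiff ℝ ∞ f) :
    Function.Injective (adaptedMap meanH1 meanH0 oneH0 (opH f hf)) :=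
  adaptedMap_injective isLinearMap_meanH0 meanH0_one fun _ _ c hm h =>
    H1.ext_of_equation (c := c) (contDiff_infty.1 hf 1) hm
      ((toLp_eq_add_smul_oneH0_iff _ _ c).1 h)

lemma injective_adaptedMap_simpleOpC (f : ℝ → ℝ) :
    Function.Injective (adaptedMap meanC1 meanC0 oneC0 (simpleOpC f)) :=
  adaptedMap_injective isLinearMap_meanC0 meanC0_one fun u₁ u₂ c hm h =>
    -- The two integrals of `f` are constants, so they are absorbed into `c` and no nonlinearity
    -- remains.
    C1.ext_of_equation (f := fun _ => 0)
      (c := (∫ s in (0 : ℝ)..1, f (u₂.1 s)) + c - ∫ s in (0 : ℝ)..1, f (u₁.1 s))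
      contDiff_const hm fun t => by
        have h1 : deriv u₁.1 t + (∫ s in (0 : ℝ)..1, f (u₁.1 s)) =
            deriv u₂.1 t + (∫ s in (0 : ℝ)..1, f (u₂.1 s)) + c * 1 :=
          congrFun (congrArg Subtype.val h) t
        linarith

lemma injective_adaptedMap_simpleOpH (f : ℝ → ℝ) :
    Function.Injective (adaptedMap meanH1 meanH0 oneH0 (simpleOpH f)) :=
  adaptedMap_injective isLinearMap_meanH0 meanH0_one fun u₁ u₂ c hm h =>
    H1.ext_of_equation (f := fun _ => 0)
      (c := (∫ s in (0 : ℝ)..1, f (u₂.1 s)) + c - ∫ s in (0 : ℝ)..1, f (u₁.1 s))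
      contDiff_const hm (by
        filter_upwards [(toLp_eq_add_smul_oneH0_iff _ _ c).1 h] with t ht
        linarith)

/-! ### The strata of the simplified operator -/

lemma hasDerivAt_mean_compOp_translate {f : ℝ → ℝ} (hf : ContDiff ℝ 2 f) (ρ h : CircleFun) (s : ℝ) :
    HasDerivAt (fun s : ℝ => (ρ * CircleFun.compOp f hf.continuous (h + s • 1)).mean)
      (ρ * CircleFun.compOp (deriv f) (hf.continuous_deriv one_le_two) (h + s • 1)).mean s := by
  have h1 : HasDerivAt (fun s : ℝ => h + s • (1 : CircleFun)) 1 s := by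
    simpa using ((hasDerivAt_id s).smul_const (1 : CircleFun)).const_add h
  have h2 := (CircleFun.hasFDerivAt_compOp hf (h + s • 1)).comp_hasDerivAt s h1
  have h3 := (CircleFun.mean.hasFDerivAt.comp_hasDerivAt s (h2.const_mul ρ))
  simp only [ContinuousLinearMap.mul_apply', mul_one] at h3
  exact h3

lemma iteratedDeriv_mean_compOp_translate {f : ℝ → ℝ} (hf : ContDiff ℝ ∞ f) (ρ h : CircleFun)
    (i : ℕ) (hi : Continuous (iteratedDeriv i f)) :
    iteratedDeriv i (fun s : ℝ => (ρ * CircleFun.compOp f hf.continuous (h + s • 1)).mean) =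
      fun s => (ρ * CircleFun.compOp (iteratedDeriv i f) hi (h + s • 1)).mean := by
  induction i generalizing f with
  | zero => simp
  | succ i ih =>
    have hf' : ContDiff ℝ ∞ (deriv f) := (contDiff_infty_iff_deriv.1 hf).2
    have : deriv (fun s : ℝ => (ρ * CircleFun.compOp f hf.continuous (h + s • 1)).mean) =
        fun s => (ρ * CircleFun.compOp (deriv f) hf'.continuous (h + s • 1)).mean :=
      funext fun s => (hasDerivAt_mean_compOp_translate (contDiff_infty.1 hf 2) ρ h s).deriv
    rw [iteratedDeriv_succ', this, ih hf' (by rw [← iteratedDeriv_succ']; exact hi)]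
    simp only [iteratedDeriv_succ']

lemma iteratedDeriv_integral_translate {f : ℝ → ℝ} (hf : ContDiff ℝ ∞ f) {u : ℝ → ℝ}
    (hp : Function.Periodic u 1) (hc : Continuous u) (i : ℕ) :
    iteratedDeriv i (fun s : ℝ => ∫ t in (0 : ℝ)..1, f (u t + s)) 0 =
      ∫ t in (0 : ℝ)..1, iteratedDeriv i f (u t) := by
  have hi : Continuous (iteratedDeriv i f) := hf.continuous_iteratedDeriv i (by exact_mod_cast le_top)
  have := congrFun (iteratedDeriv_mean_compOp_translate hf 1 (CircleFun.ofPeriodic u hp hc) i hi) 0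
  simpa [CircleFun.mean_apply] using this

lemma mem_simpleStrataC_iff {f : ℝ → ℝ} (hf : ContDiff ℝ ∞ f) (k : ℕ) (u : C1) :
    u ∈ simpleStrataC f k ↔
      ∀ i, 1 ≤ i → i ≤ k → ∫ t in (0 : ℝ)..1, iteratedDeriv i f (u.1 t) = 0 := by
  have hU := mem_stratum_iff (u := u) isLinearMap_meanC0 meanC0_one (injective_adaptedMap_simpleOpC f)
    (U := fun s => ⟨fun t => u.1 t + s, fun t => by simp only [u.2.1 t],
      u.2.2.add contDiff_const⟩)
    (β := fun s => -(∫ t in (0 : ℝ)..1, f (u.1 t)) + ∫ t in (0 : ℝ)..1, f (u.1 t + s))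
    (Eventually.of_forall fun s => ⟨Subtype.ext (funext fun t => by
      change deriv (fun t => u.1 t + s) t + _ = (deriv u.1 t + _) + _ * (1 : ℝ)
      rw [deriv_add_const]
      ring), by
      unfold meanC1
      rw [intervalIntegral.integral_add (u.2.2.continuous.intervalIntegrable _ _) (by simp)]
      simp⟩) k
  refine hU.trans (forall_congr' fun i => forall_congr' fun hi => ?_)
  rw [iteratedDeriv_const_add hi, iteratedDeriv_integral_translate hf u.2.1 u.2.2.continuous]

lemma mem_simpleStrataH_iff {f : ℝ → ℝ} (hf : ContDiff ℝ ∞ f) (k : ℕ) (u : H1) :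
    u ∈ simpleStrataH f k ↔
      ∀ i, 1 ≤ i → i ≤ k → ∫ t in (0 : ℝ)..1, iteratedDeriv i f (u.1 t) = 0 := by
  have hd : ∀ s, deriv (fun t => u.1 t + s) = deriv u.1 := fun s => funext fun t => deriv_add_const s
  have hU := mem_stratum_iff (u := u) isLinearMap_meanH0 meanH0_one (injective_adaptedMap_simpleOpH f)
    (U := fun s => ⟨fun t => u.1 t + s, fun t => by simp only [u.2.1 t],
      fun a b => (u.2.2.1 a b).add
        (LipschitzOnWith.absolutelyContinuousOnInterval (K := 0) (f := fun _ => s)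
          (LipschitzWith.const s).lipschitzOnWith), by rw [hd]; exact u.2.2.2⟩)
    (β := fun s => -(∫ t in (0 : ℝ)..1, f (u.1 t)) + ∫ t in (0 : ℝ)..1, f (u.1 t + s))
    (Eventually.of_forall fun s => ⟨(toLp_eq_add_smul_oneH0_iff _ _ _).2
      (Eventually.of_forall fun t => by
        simp only [deriv_add_const]
        ring), by
      unfold meanH1
      rw [intervalIntegral.integral_add (u.continuous.intervalIntegrable _ _) (by simp)]
      simp⟩) k
  refine hU.trans (forall_congr' fun i => forall_congr' fun hi => ?_)
  rw [iteratedDeriv_const_add hi, iteratedDeriv_integral_translate hf u.2.1 u.continuous]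

/-! ### Weighted means of `γ̂_k` along a function on the circle -/

/-- The map which sends a weight `ρ` to the vector of means of `ρ f^{(i)}(v)`, `i = 1, …, k`. -/
noncomputable def moment (f : ℝ → ℝ) (hf : ContDiff ℝ ∞ f) (k : ℕ) (v : CircleFun) :
    CircleFun →L[ℝ] (Fin k → ℝ) :=
  ContinuousLinearMap.pi fun i => CircleFun.mean.comp
    (ContinuousLinearMap.mul ℝ CircleFun (CircleFun.compOp (iteratedDeriv (i.1 + 1) f)
      (hf.continuous_iteratedDeriv _ (by exact_mod_cast le_top)) v))

lemma continuous_gammaHat {f : ℝ → ℝ} (hf : ContDiff ℝ ∞ f) (k : ℕ) :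
    Continuous (gammaHat f k) :=
  continuous_pi fun i => hf.continuous_iteratedDeriv (i.1 + 1) (by exact_mod_cast le_top)

lemma moment_apply {f : ℝ → ℝ} (hf : ContDiff ℝ ∞ f) (k : ℕ) (v ρ : CircleFun) (i : Fin k) :
    moment f hf k v ρ i =
      ∫ t in (0 : ℝ)..1, iteratedDeriv (i.1 + 1) f (v (t : UnitAddCircle)) * ρ (t : UnitAddCircle) :=
  rfl

/-- The function `g(γ̂_k(v))` on the circle. -/
noncomputable def pairing {f : ℝ → ℝ} (hf : ContDiff ℝ ∞ f) {k : ℕ} (v : CircleFun)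
    (g : (Fin k → ℝ) →ₗ[ℝ] ℝ) : CircleFun :=
  ⟨fun x => g (gammaHat f k (v x)), (LinearMap.continuous_of_finiteDimensional g).comp
    ((continuous_gammaHat hf k).comp v.continuous)⟩

lemma apply_moment {f : ℝ → ℝ} (hf : ContDiff ℝ ∞ f) {k : ℕ} (v ρ : CircleFun)
    (g : (Fin k → ℝ) →ₗ[ℝ] ℝ) :
    g (moment f hf k v ρ) = (pairing hf v g * ρ).mean := by
  have h : pairing hf v g * ρ = ∑ i : Fin k, g (fun j => if i = j then 1 else 0) •
      (CircleFun.compOp (iteratedDeriv (i.1 + 1) f)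
        (hf.continuous_iteratedDeriv _ (by exact_mod_cast le_top)) v * ρ) := by
    ext x
    have : g (gammaHat f k (v x)) = ∑ i : Fin k, gammaHat f k (v x) i • g (fun j => if i = j then 1 else 0) :=
      g.pi_apply_eq_sum_univ _
    simp only [pairing, ContinuousMap.mul_apply, ContinuousMap.coe_mk, ContinuousMap.sum_apply,
      ContinuousMap.smul_apply, this, Finset.sum_mul, smul_eq_mul, CircleFun.compOp_apply, gammaHat]
    exact Finset.sum_congr rfl fun i _ => by ring
  rw [h, map_sum, g.pi_apply_eq_sum_univ]
  refine Finset.sum_congr rfl fun i _ => ?_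
  rw [map_smul, smul_eq_mul, smul_eq_mul, mul_comm]
  rfl

/-- Otherwise a nonzero functional `g` kills the range. Taking `g(γ̂_k(v))` itself as the weight
gives `g(γ̂_k(v)) = 0`, and by the intermediate value theorem `γ̂_k` maps all of `(v x, v y)` into
the hyperplane `ker g`. -/
lemma moment_surjective {f : ℝ → ℝ} (hf : ContDiff ℝ ∞ f) {k : ℕ} (hk : IsGood f k) {v : CircleFun}
    {x y : UnitAddCircle} (hxy : v x < v y) : Function.Surjective (moment f hf k v) := by
  by_contra hns
  have hlt : LinearMap.range (moment f hf k v).toLinearMap < ⊤ :=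
    lt_top_iff_ne_top.2 fun h => hns (LinearMap.range_eq_top.1 h)
  obtain ⟨g, hg0, hg⟩ := Submodule.exists_le_ker_of_lt_top _ hlt
  have h0 : pairing hf v g = 0 := by
    refine CircleFun.eq_zero_of_mean_sq ?_
    rw [← apply_moment]
    exact hg ⟨_, rfl⟩
  refine hk.2 (v x) (v y) hxy (LinearMap.ker g) ?_ ?_
  · have := Module.Dual.finrank_ker_add_one_of_ne_zero (f := g) hg0
    simpa using this
  · rintro _ ⟨z, hz, rfl⟩
    obtain ⟨w, rfl⟩ := mem_range_of_exists_le_of_exists_ge v.continuous ⟨x, hz.1.le⟩ ⟨y, hz.2.le⟩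
    exact DFunLike.congr_fun h0 w

/-! ### Change of the parameter of the circle -/

/-- `θ` is the inverse of `x ↦ ∫₀ˣ ρ`: the time spent near a point is proportional to `ρ` there, so
averaging along `θ` is averaging with weight `ρ`. -/
lemma exists_reparametrization {ρ : CircleFun} (hpos : ∀ x, 0 < ρ x) (hρ : ρ.mean = 1) :
    ∃ θ : ℝ → ℝ, (∀ t, HasDerivAt θ (ρ (θ t : UnitAddCircle))⁻¹ t) ∧ (∀ t, θ (t + 1) = θ t + 1) ∧
      ∀ g : CircleFun, ∫ t in (0 : ℝ)..1, g (θ t : UnitAddCircle) = (ρ * g).mean := by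
  set τ : ℝ → ℝ := fun x => ∫ t in (0 : ℝ)..x, ρ (t : UnitAddCircle) with hτ
  have hτ' : ∀ x : ℝ, HasDerivAt τ (ρ (x : UnitAddCircle)) x := fun x =>
    intervalIntegral.integral_hasDerivAt_right (ρ.continuous_coe.intervalIntegrable 0 x)
      (ρ.continuous_coe.stronglyMeasurableAtFilter _ _) ρ.continuous_coe.continuousAt
  have hτ1 : ∀ x, τ (x + 1) = τ x + 1 := fun x => by
    have h1 := ρ.periodic_coe.intervalIntegral_add_eq_add 0 x
      (fun a b => ρ.continuous_coe.intervalIntegrable a b)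
    simp only [zero_add] at h1
    have h2 : ∫ t in (0 : ℝ)..1, ρ (t : UnitAddCircle) = 1 := hρ
    rw [h2] at h1
    exact h1
  have hmono : StrictMono τ := strictMono_of_deriv_pos fun x => by
    rw [(hτ' x).deriv]
    exact hpos _
  have hpos' : 0 < ∫ t in (0 : ℝ)..1, ρ (t : UnitAddCircle) := by
    rw [← CircleFun.mean_apply, hρ]
    exact one_pos
  have hcont : Continuous τ := continuous_iff_continuousAt.2 fun x => (hτ' x).continuousAt
  have hsurj : Function.Surjective τ := hcont.surjective
    (ρ.periodic_coe.tendsto_atTop_intervalIntegral_of_pos hpos' one_pos)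
    (ρ.periodic_coe.tendsto_atBot_intervalIntegral_of_pos hpos' one_pos)
  set e := hmono.orderIsoOfSurjective τ hsurj with he
  have heτ : ∀ x, τ (e.symm x) = x := fun x => e.apply_symm_apply x
  have hτe : ∀ x, e.symm (τ x) = x := fun x => e.symm_apply_apply x
  have hd : ∀ t, HasDerivAt e.symm (ρ (e.symm t : UnitAddCircle))⁻¹ t := fun t =>
    (hτ' (e.symm t)).of_local_left_inverse e.symm.continuous.continuousAt (hpos _).ne'
      (Eventually.of_forall heτ)
  refine ⟨e.symm, hd, fun t => ?_, fun g => ?_⟩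
  · apply hmono.injective
    rw [heτ, hτ1, heτ]
  · have := intervalIntegral.integral_comp_mul_deriv (a := 0) (b := 1) (f := τ)
      (f' := fun x => ρ (x : UnitAddCircle)) (g := fun t => g (e.symm t : UnitAddCircle))
      (fun x _ => hτ' x) ρ.continuous_coe.continuousOn (g.continuous_coe.comp e.symm.continuous)
    have h0 : τ 0 = 0 := by simp [hτ]
    have h1 : τ 1 = 1 := by rw [← zero_add (1 : ℝ), hτ1, h0]
    rw [h0, h1] at this
    rw [← this, CircleFun.mean_apply]
    refine intervalIntegral.integral_congr fun x _ => ?_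
    simp only [Function.comp, hτe, ContinuousMap.mul_apply]
    ring

lemma CircleFun.pos_of_mem_ball {ρ : CircleFun} (h : ρ ∈ Metric.ball (1 : CircleFun) 1)
    (x : UnitAddCircle) : 0 < ρ x := by
  rw [mem_ball_iff_norm] at h
  have := (ρ - 1).abs_apply_le x
  rw [ContinuousMap.sub_apply, ContinuousMap.one_apply] at this
  linarith [(abs_lt.1 (this.trans_lt h)).1]

/-! ### Nonemptiness of the strata of the simplified operator -/

lemma exists_lt_of_moment_one_eq_zero {f : ℝ → ℝ} (hf : ContDiff ℝ ∞ f) {k : ℕ} (hk : IsGood f k)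
    {v : CircleFun} (hv : moment f hf k v 1 = 0) : ∃ x y, v x < v y := by
  by_contra! H
  refine hk.1 (v 0) (funext fun i => ?_)
  have hi := congrFun hv i
  rw [moment_apply] at hi
  have hconst : ∀ x, v x = v 0 := fun x => le_antisymm (H 0 x) (H x 0)
  simp only [hconst] at hi
  simp only [ContinuousMap.one_apply, mul_one, intervalIntegral.integral_const, sub_zero,
    one_smul] at hi
  exact hi

/-- Adding a constant to a weight adjusts its mean without changing its moment, since the constant
weight has zero moment. -/
lemma mean_moment_surjective {f : ℝ → ℝ} (hf : ContDiff ℝ ∞ f) {k : ℕ} (hk : IsGood f k)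
    {v : CircleFun} (hv : moment f hf k v 1 = 0) :
    Function.Surjective (CircleFun.mean.prod (moment f hf k v)) := by
  obtain ⟨x, y, hxy⟩ := exists_lt_of_moment_one_eq_zero hf hk hv
  rintro ⟨a, m⟩
  obtain ⟨η, hη⟩ := moment_surjective hf hk hxy m
  refine ⟨η + (a - η.mean) • (1 : CircleFun), ?_⟩
  ext1
  · simp
  · simp [hv, hη]

/-- After the change of parameter the moment is an average of points of the curve against a
probability measure. -/
lemma moment_mem_closure_convexHull {f : ℝ → ℝ} (hf : ContDiff ℝ ∞ f) (k : ℕ) (v : CircleFun)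
    {ρ : CircleFun} (hpos : ∀ x, 0 < ρ x) (hρ : ρ.mean = 1) :
    moment f hf k v ρ ∈ closure (convexHull ℝ (range (gammaHat f k))) := by
  obtain ⟨θ, hθ', -, hθ⟩ := exists_reparametrization hpos hρ
  have hθc : Continuous θ := continuous_iff_continuousAt.2 fun x => (hθ' x).continuousAt
  have hc : Continuous fun t => gammaHat f k (v (θ t : UnitAddCircle)) :=
    (continuous_gammaHat hf k).comp (v.continuous_coe.comp hθc)
  have : IsProbabilityMeasure periodMeasure := ⟨by simp⟩
  have hint : ∀ {E : Type} [NormedAddCommGroup E] {g : ℝ → E}, Continuous g →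
      Integrable g periodMeasure := fun hg =>
    (hg.integrableOn_Icc (a := (0 : ℝ)) (b := 1)).mono_set Ioc_subset_Icc_self
  have key := (convex_convexHull ℝ (range (gammaHat f k))).closure.integral_mem (μ := periodMeasure)
    isClosed_closure
    (Eventually.of_forall fun t => subset_closure (subset_convexHull ℝ _ ⟨v (θ t : UnitAddCircle), rfl⟩))
    (hint hc)
  convert! key using 1
  ext i
  rw [eval_integral (fun i => hint (g := fun t => gammaHat f k (v (θ t : UnitAddCircle)) i)
    ((continuous_apply i).comp hc))]
  have := hθ (CircleFun.compOp (iteratedDeriv (i.1 + 1) f)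
    (hf.continuous_iteratedDeriv _ (by exact_mod_cast le_top)) v)
  rw [mul_comm, intervalIntegral.integral_of_le zero_le_one] at this
  exact this.symm

/-- By the open mapping theorem, positive weights of mean `1` near the weight `1` already have
moments covering a neighbourhood of `0`. -/
lemma zero_mem_interior_of_moment_one_eq_zero {f : ℝ → ℝ} (hf : ContDiff ℝ ∞ f) {k : ℕ}
    (hk : IsGood f k) {v : CircleFun} (hv : moment f hf k v 1 = 0) :
    (0 : Fin k → ℝ) ∈ interior (convexHull ℝ (range (gammaHat f k))) := by
  set C := convexHull ℝ (range (gammaHat f k)) with hC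
  have hopen := (CircleFun.mean.prod (moment f hf k v)).isOpenMap (mean_moment_surjective hf hk hv)
  have h1 := hopen.image_mem_nhds (Metric.ball_mem_nhds (1 : CircleFun) one_pos)
  have e1 : (CircleFun.mean.prod (moment f hf k v)) 1 = (1, 0) := by ext1 <;> simp [hv]
  rw [e1] at h1
  have h2 : ∀ᶠ m in 𝓝 (0 : Fin k → ℝ), m ∈ closure C := by
    have : Tendsto (fun m : Fin k → ℝ => ((1 : ℝ), m)) (𝓝 0) (𝓝 (1, 0)) :=
      (continuous_const.prodMk continuous_id).tendsto' _ _ rfl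
    filter_upwards [this h1] with m hm
    obtain ⟨ρ, hρ, e⟩ := hm
    have ea : ρ.mean = 1 := congrArg Prod.fst e
    have em : moment f hf k v ρ = m := congrArg Prod.snd e
    rw [← em]
    exact moment_mem_closure_convexHull hf k v (CircleFun.pos_of_mem_ball hρ) ea
  have hint : (0 : Fin k → ℝ) ∈ interior (closure C) := mem_interior_iff_mem_nhds.2 h2
  -- Passing from the closed hull to the hull requires the hull to have interior points; this holds
  -- because the curve spans affinely, as its affine span is closed and contains the closed hull.
  have hspan : affineSpan ℝ (range (gammaHat f k)) = ⊤ := by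
    have h3 : affineSpan ℝ (closure C) = ⊤ := affineSpan_eq_top_of_nonempty_interior
      ⟨0, by rwa [(convex_convexHull ℝ _).closure.convexHull_eq]⟩
    rw [← top_le_iff, ← h3, affineSpan_le]
    refine closure_minimal (convexHull_subset_affineSpan _) ?_
    exact AffineSubspace.closed_of_finiteDimensional _
  have hne : (interior C).Nonempty := interior_convexHull_nonempty_iff_affineSpan_eq_top.2 hspan
  rwa [(convex_convexHull ℝ _).interior_closure_eq_interior_of_nonempty_interior hne] at hint

/-- Test with the positive part of `h`, made strictly positive by adding `δ` and letting `δ → 0`: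
the positive part then has a square of mean zero. -/
lemma nonpos_of_forall_mean_mul_nonpos {h : CircleFun}
    (H : ∀ ρ : CircleFun, (∀ x, 0 < ρ x) → (h * ρ).mean ≤ 0) (x : UnitAddCircle) : h x ≤ 0 := by
  have h1 : (h * (h ⊔ 0)).mean ≤ 0 := by
    have hc : Continuous fun δ : ℝ => (h * ((h ⊔ 0) + δ • 1)).mean := by fun_prop
    have hlim : Tendsto (fun δ : ℝ => (h * ((h ⊔ 0) + δ • 1)).mean) (𝓝[>] 0)
        (𝓝 (h * (h ⊔ 0)).mean) :=
      tendsto_nhdsWithin_of_tendsto_nhds (hc.tendsto' _ _ (by simp))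
    refine le_of_tendsto hlim ?_
    filter_upwards [self_mem_nhdsWithin] with δ hδ
    refine H _ fun x => ?_
    simp only [ContinuousMap.add_apply, ContinuousMap.sup_apply, ContinuousMap.zero_apply,
      ContinuousMap.smul_apply, ContinuousMap.one_apply, smul_eq_mul, mul_one]
    exact add_pos_of_nonneg_of_pos le_sup_right hδ
  have h2 : h * (h ⊔ 0) = (h ⊔ 0) * (h ⊔ 0) := by
    ext x
    simp only [ContinuousMap.mul_apply, ContinuousMap.sup_apply, ContinuousMap.zero_apply]
    rcases le_total (h x) 0 with hx | hx
    · simp [sup_eq_right.2 hx]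
    · simp [sup_eq_left.2 hx]
  rw [h2] at h1
  have h3 : 0 ≤ ((h ⊔ 0) * (h ⊔ 0)).mean :=
    intervalIntegral.integral_nonneg zero_le_one fun t _ => mul_self_nonneg _
  have h4 := CircleFun.eq_zero_of_mean_sq (le_antisymm h1 h3)
  have := DFunLike.congr_fun h4 x
  simp only [ContinuousMap.sup_apply, ContinuousMap.zero_apply] at this
  exact sup_eq_right.1 this

/-- The function `R sin(2πt)` on the circle. -/
noncomputable def sine (R : ℝ) : CircleFun :=
  CircleFun.ofPeriodic (fun t => R * Real.sin (2 * Real.pi * t))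
    (fun t => by
      have : 2 * Real.pi * (t + 1) = 2 * Real.pi * t + 2 * Real.pi := by ring
      simp only [this, Real.sin_add_two_pi])
    (by fun_prop)

lemma Icc_subset_range_sine {R : ℝ} : Icc (-R) R ⊆ range (sine R) := by
  rintro y ⟨h1, h2⟩
  refine mem_range_of_exists_le_of_exists_ge (sine R).continuous
    ⟨((-1 / 4 : ℝ) : UnitAddCircle), ?_⟩ ⟨((1 / 4 : ℝ) : UnitAddCircle), ?_⟩
  · have : sine R ((-1 / 4 : ℝ) : UnitAddCircle) = -R := by
      change R * Real.sin (2 * Real.pi * (-1 / 4)) = -R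
      rw [show 2 * Real.pi * (-1 / 4) = -(Real.pi / 2) by ring, Real.sin_neg, Real.sin_pi_div_two]
      ring
    exact this.trans_le h1
  · have : sine R ((1 / 4 : ℝ) : UnitAddCircle) = R := by
      change R * Real.sin (2 * Real.pi * (1 / 4)) = R
      rw [show 2 * Real.pi * (1 / 4) = Real.pi / 2 by ring, Real.sin_pi_div_two]
      ring
    exact h2.trans this.ge

/-- Sines of growing amplitude exhaust the line. If every open convex cone of moments missed `0`,
Hahn–Banach would give unit functionals nonpositive on ever longer arcs of `γ̂_k`; compactness of
the unit sphere yields one nonpositive on the whole curve, which is impossible when `0` is interior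
to the hull. -/
lemma exists_moment_sine_eq_zero {f : ℝ → ℝ} (hf : ContDiff ℝ ∞ f) {k : ℕ} (hk : IsGood f k)
    (h0 : (0 : Fin k → ℝ) ∈ interior (convexHull ℝ (range (gammaHat f k)))) :
    ∃ R : ℝ, ∃ ρ : CircleFun, (∀ x, 0 < ρ x) ∧ moment f hf k (sine R) ρ = 0 := by
  by_contra! H
  set K : ℕ → Set ((Fin k → ℝ) →L[ℝ] ℝ) := fun n =>
    Metric.sphere 0 1 ∩ ⋂ x ∈ Icc (-(n + 1 : ℝ)) (n + 1), {g | g (gammaHat f k x) ≤ 0} with hK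
  have hclosed : ∀ n, IsClosed (K n) := fun n => Metric.isClosed_sphere.inter
    (isClosed_biInter fun x _ => isClosed_le (by fun_prop) continuous_const)
  obtain ⟨g, hg⟩ : (⋂ n, K n).Nonempty := by
    refine IsCompact.nonempty_iInter_of_sequence_nonempty_isCompact_isClosed K (fun n => ?_)
      (fun n => ?_) ((isCompact_sphere _ _).inter_right (isClosed_biInter fun x _ =>
        isClosed_le (by fun_prop) continuous_const)) hclosed
    · refine inter_subset_inter_right _ (biInter_subset_biInter_left (Icc_subset_Icc ?_ ?_)) <;>
      · push_cast
        linarith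
    -- The shift by one keeps the sine nonconstant also for `n = 0`.
    · set R : ℝ := n + 1 with hR
      have hRpos : 0 < R := by positivity
      obtain ⟨x, hx⟩ := Icc_subset_range_sine (R := R) (left_mem_Icc.2 (by linarith))
      obtain ⟨y, hy⟩ := Icc_subset_range_sine (R := R) (right_mem_Icc.2 (by linarith))
      have hsurj := moment_surjective hf hk (v := sine R) (x := x) (y := y) (by linarith)
      have hpo : IsOpen {ρ : CircleFun | ∀ x, 0 < ρ x} := by
        have := ContinuousMap.isOpen_setOfPred_mapsTo (X := UnitAddCircle) (Y := ℝ) isCompact_univ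
          (isOpen_Ioi (a := (0 : ℝ)))
        simpa [MapsTo] using this
      have hpc : Convex ℝ {ρ : CircleFun | ∀ x, 0 < ρ x} := by
        intro ρ hρ η hη a b ha hb hab x
        exact convex_Ioi (0 : ℝ) (hρ x) (hη x) ha hb hab
      have hconv := hpc.linear_image (moment f hf k (sine R)).toLinearMap
      have hop := (moment f hf k (sine R)).isOpenMap hsurj _ hpo
      obtain ⟨g, hg⟩ := geometric_hahn_banach_open_point hconv hop (x := 0) (by
        rintro ⟨ρ, hρ, e⟩
        exact H R ρ hρ e)
      rw [map_zero] at hg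
      have hgne : g ≠ 0 := by
        rintro rfl
        exact lt_irrefl _ (hg _ ⟨1, fun _ => one_pos, rfl⟩)
      refine ⟨‖g‖⁻¹ • g, ?_, ?_⟩
      · rw [mem_sphere_zero_iff_norm, norm_smul, norm_inv, norm_norm,
          inv_mul_cancel₀ (norm_ne_zero_iff.2 hgne)]
      · refine mem_iInter₂.2 fun z hz => ?_
        obtain ⟨w, rfl⟩ := Icc_subset_range_sine hz
        have := nonpos_of_forall_mean_mul_nonpos (h := pairing hf (sine R) g.toLinearMap)
          (fun ρ hρ => by
            rw [← apply_moment]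
            exact (hg _ ⟨ρ, hρ, rfl⟩).le) w
        exact mul_nonpos_of_nonneg_of_nonpos (inv_nonneg.2 (norm_nonneg _)) this
  have hg1 : ‖g‖ = 1 := mem_sphere_zero_iff_norm.1 (mem_iInter.1 hg 0).1
  have hgle : ∀ x, g (gammaHat f k x) ≤ 0 := fun x => by
    obtain ⟨n, hn⟩ := exists_nat_ge |x|
    have hx := abs_le.1 hn
    exact mem_iInter₂.1 (mem_iInter.1 hg n).2 x ⟨by linarith [hx.1], by linarith [hx.2]⟩
  have hCle : convexHull ℝ (range (gammaHat f k)) ⊆ {z | g z ≤ 0} :=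
    convexHull_min (range_subset_iff.2 hgle) (convex_halfSpace_le g.toLinearMap.isLinear 0)
  have hgne : g ≠ 0 := by
    rintro rfl
    simp at hg1
  obtain ⟨z, hz⟩ : ∃ z, 0 < g z := by
    by_contra! Hz
    refine hgne (ContinuousLinearMap.ext fun z => le_antisymm (Hz z) ?_)
    have := Hz (-z)
    rw [map_neg] at this
    simpa using this
  have hlim : Tendsto (fun t : ℝ => t • z) (𝓝[>] 0) (𝓝 0) :=
    tendsto_nhdsWithin_of_tendsto_nhds (Continuous.tendsto' (by fun_prop) _ _ (zero_smul ℝ z))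
  obtain ⟨t, ht, htpos⟩ := 
    ((hlim.eventually (mem_interior_iff_mem_nhds.1 h0)).and self_mem_nhdsWithin).exists
  have : g (t • z) ≤ 0 := hCle ht
  rw [map_smul, smul_eq_mul] at this
  exact this.not_gt (mul_pos htpos hz)

lemma moment_one_eq_zero_iff {f : ℝ → ℝ} (hf : ContDiff ℝ ∞ f) (k : ℕ) {u : ℝ → ℝ}
    (hp : Function.Periodic u 1) (hc : Continuous u) :
    moment f hf k (CircleFun.ofPeriodic u hp hc) 1 = 0 ↔
      ∀ i, 1 ≤ i → i ≤ k → ∫ t in (0 : ℝ)..1, iteratedDeriv i f (u t) = 0 := by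
  constructor
  · intro h i hi hik
    have := congrFun h ⟨i - 1, by omega⟩
    rw [moment_apply] at this
    simpa [Nat.sub_add_cancel hi] using this
  · intro h
    ext i
    rw [moment_apply]
    simpa using h (i.1 + 1) (by omega) (by omega)

lemma contDiff_reparametrization {ρ : CircleFun} (hpos : ∀ x, 0 < ρ x) {θ : ℝ → ℝ}
    (hθ : ∀ t, HasDerivAt θ (ρ (θ t : UnitAddCircle))⁻¹ t) : ContDiff ℝ 1 θ := by
  have hθc : Continuous θ := continuous_iff_continuousAt.2 fun x => (hθ x).continuousAt
  rw [contDiff_one_iff_deriv]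
  refine ⟨fun t => (hθ t).differentiableAt, ?_⟩
  rw [show deriv θ = fun t => (ρ (θ t : UnitAddCircle))⁻¹ from funext fun t => (hθ t).deriv]
  exact (ρ.continuous_coe.comp hθc).inv₀ fun t => (hpos _).ne'

lemma simpleStrataC_nonempty {f : ℝ → ℝ} (hf : ContDiff ℝ ∞ f) {k : ℕ} (hk : IsGood f k)
    (h0 : (0 : Fin k → ℝ) ∈ interior (convexHull ℝ (range (gammaHat f k)))) :
    (simpleStrataC f k).Nonempty := by
  obtain ⟨R, ρ', hpos', hm'⟩ := exists_moment_sine_eq_zero hf hk h0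
  have hmp := CircleFun.mean_pos hpos'
  set ρ : CircleFun := (ρ'.mean)⁻¹ • ρ' with hρ
  have hpos : ∀ x, 0 < ρ x := fun x => mul_pos (inv_pos.2 hmp) (hpos' x)
  have hmean : ρ.mean = 1 := by
    rw [hρ, map_smul, smul_eq_mul, inv_mul_cancel₀ hmp.ne']
  have hm : moment f hf k (sine R) ρ = 0 := by rw [hρ, map_smul, hm', smul_zero]
  obtain ⟨θ, hθ, hθ1, hθint⟩ := exists_reparametrization hpos hmean
  have hsin : ContDiff ℝ 1 fun t : ℝ => R * Real.sin (2 * Real.pi * t) := by fun_prop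
  have hper : Function.Periodic (fun t => R * Real.sin (2 * Real.pi * θ t)) 1 := fun t => by
    have : 2 * Real.pi * θ (t + 1) = 2 * Real.pi * θ t + 2 * Real.pi := by rw [hθ1]; ring
    simp only [this, Real.sin_add_two_pi]
  refine ⟨⟨fun t => R * Real.sin (2 * Real.pi * θ t), hper,
    hsin.comp (contDiff_reparametrization hpos hθ)⟩, ?_⟩
  · refine (mem_simpleStrataC_iff hf k _).2 ?_
    intro i hi hik
    have h1 := hθint (CircleFun.compOp (iteratedDeriv i f)
      (hf.continuous_iteratedDeriv _ (by exact_mod_cast le_top)) (sine R))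
    have h2 := congrFun hm ⟨i - 1, by omega⟩
    rw [moment_apply] at h2
    simp only [Nat.sub_add_cancel hi] at h2
    refine h1.trans ?_
    rw [mul_comm]
    exact h2

lemma simpleStrataC_nonempty_iff {f : ℝ → ℝ} (hf : ContDiff ℝ ∞ f) {k : ℕ} (hk : IsGood f k) :
    (simpleStrataC f k).Nonempty ↔
      (0 : Fin k → ℝ) ∈ interior (convexHull ℝ (range (gammaHat f k))) := by
  refine ⟨fun ⟨u, hu⟩ => ?_, simpleStrataC_nonempty hf hk⟩
  rw [mem_simpleStrataC_iff hf, ← moment_one_eq_zero_iff hf k u.2.1 u.2.2.continuous] at hu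
  exact zero_mem_interior_of_moment_one_eq_zero hf hk hu

lemma simpleStrataH_nonempty_iff {f : ℝ → ℝ} (hf : ContDiff ℝ ∞ f) {k : ℕ} (hk : IsGood f k) :
    (simpleStrataH f k).Nonempty ↔
      (0 : Fin k → ℝ) ∈ interior (convexHull ℝ (range (gammaHat f k))) := by
  constructor
  · rintro ⟨u, hu⟩
    rw [mem_simpleStrataH_iff hf, ← moment_one_eq_zero_iff hf k u.2.1 u.continuous] at hu
    exact zero_mem_interior_of_moment_one_eq_zero hf hk hu
  · intro h0
    obtain ⟨u, hu⟩ := simpleStrataC_nonempty hf hk h0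
    refine ⟨u.toH1, ?_⟩
    rw [mem_simpleStrataH_iff hf]
    exact (mem_simpleStrataC_iff hf k u).1 hu

/-! ### Smooth implicit functions and partial derivatives -/

/-- The inverse function theorem for `(p, z) ↦ (p, Θ (p, z))`. The local uniqueness clause is what
later identifies the solutions at `ε = 0`. -/
lemma exists_contDiffAt_implicit {P E F : Type*} [NormedAddCommGroup P] [NormedSpace ℝ P]
    [CompleteSpace P] [NormedAddCommGroup E] [NormedSpace ℝ E] [CompleteSpace E]
    [NormedAddCommGroup F] [NormedSpace ℝ F] [CompleteSpace F] {n : ℕ} (hn : n ≠ 0)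
    {Θ : P × E → F} (hΘ : ContDiff ℝ n Θ) {p₀ : P} {z₀ : E} (h0 : Θ (p₀, z₀) = 0)
    (hB : Function.Bijective fun w : E => fderiv ℝ Θ (p₀, z₀) (0, w)) :
    ∃ ζ : P → E, ContDiffAt ℝ n ζ p₀ ∧ (∀ᶠ p in 𝓝 p₀, Θ (p, ζ p) = 0) ∧
      ∀ᶠ q in 𝓝 (p₀, z₀), Θ q = 0 → ζ q.1 = q.2 := by
  set L := fderiv ℝ Θ (p₀, z₀) with hL
  have hLd : HasFDerivAt Θ L (p₀, z₀) :=
    ((hΘ.differentiable (by exact_mod_cast hn)) _).hasFDerivAt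
  have hadd : ∀ q w, L (q, w) = L (q, 0) + L (0, w) := fun q w => by rw [← map_add]; simp
  set T : P × E → P × F := fun q => (q.1, Θ q) with hT
  have hTc : ContDiff ℝ n T := contDiff_fst.prodMk hΘ
  set A : (P × E) →L[ℝ] (P × F) := (ContinuousLinearMap.fst ℝ P E).prod L with hA
  have hTd : HasFDerivAt T A (p₀, z₀) := hasFDerivAt_fst.prodMk hLd
  have hinj : LinearMap.ker A.toLinearMap = ⊥ := by
    refine LinearMap.ker_eq_bot'.2 ?_
    rintro ⟨q, w⟩ h
    have h1 : q = 0 := congrArg Prod.fst h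
    have h2 : L (q, w) = 0 := congrArg Prod.snd h
    subst h1
    have h3 : w = 0 := hB.1 (h2.trans (map_zero L).symm)
    simp [h3]
  have hsurj : LinearMap.range A.toLinearMap = ⊤ := by
    refine LinearMap.range_eq_top.2 ?_
    rintro ⟨q, y⟩
    obtain ⟨w, hw⟩ := hB.2 (y - L (q, 0))
    refine ⟨(q, w), Prod.ext rfl ?_⟩
    change L (q, w) = y
    rw [hadd]
    simp only at hw
    rw [hw]
    abel
  set e := ContinuousLinearEquiv.ofBijective A hinj hsurj with he
  have hTe : HasFDerivAt T (e : (P × E) →L[ℝ] (P × F)) (p₀, z₀) := by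
    rw [he, ContinuousLinearEquiv.coe_ofBijective]
    exact hTd
  have hn' : (n : WithTop ℕ∞) ≠ 0 := by exact_mod_cast hn
  set S := hTc.contDiffAt.toOpenPartialHomeomorph T hTe hn' with hS
  have hST : ∀ q, S q = T q := fun q => rfl
  have hmem : (p₀, z₀) ∈ S.source := hTc.contDiffAt.mem_toOpenPartialHomeomorph_source hTe hn'
  have hT0 : S (p₀, z₀) = (p₀, 0) := Prod.ext rfl h0
  have htgt : (p₀, (0 : F)) ∈ S.target := hT0 ▸ S.map_source hmem
  have hι : Continuous fun p : P => (p, (0 : F)) := by fun_prop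
  refine ⟨fun p => (S.symm (p, 0)).2, ?_, ?_, ?_⟩
  · have h1 : ContDiffAt ℝ n S.symm (p₀, 0) := by
      have := hTc.contDiffAt.to_localInverse hTe hn'
      rwa [show T (p₀, z₀) = (p₀, 0) from hT0] at this
    exact contDiffAt_snd.comp p₀ (h1.comp p₀ (contDiffAt_id.prodMk contDiffAt_const))
  · have : ∀ᶠ p in 𝓝 p₀, (p, (0 : F)) ∈ S.target :=
      hι.continuousAt.eventually (S.open_target.mem_nhds htgt)
    filter_upwards [this] with p hp
    have h1 : T (S.symm (p, 0)) = (p, 0) := S.right_inv hp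
    have h2 : (S.symm (p, 0)).1 = p := congrArg Prod.fst h1
    have h3 : Θ (S.symm (p, 0)) = 0 := congrArg Prod.snd h1
    have h4 : (p, (S.symm (p, 0)).2) = S.symm (p, 0) := Prod.ext h2.symm rfl
    rw [h4, h3]
  · filter_upwards [S.open_source.mem_nhds hmem] with q hq hΘq
    have h1 : S.symm (S q) = q := S.left_inv hq
    have h2 : S q = (q.1, 0) := Prod.ext rfl hΘq
    rw [h2] at h1
    exact congrArg Prod.snd h1

/-- Each derivative in the first variable costs one order of joint differentiability. -/
lemma contDiffAt_iteratedDeriv_fst {Q : Type*} [NormedAddCommGroup Q] [NormedSpace ℝ Q] (n i : ℕ)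
    {b : ℝ × Q → ℝ} {p₀ : ℝ × Q} (hb : ContDiffAt ℝ ((n + i : ℕ) : WithTop ℕ∞) b p₀) :
    ContDiffAt ℝ n (fun p : ℝ × Q => iteratedDeriv i (fun s => b (s, p.2)) p.1) p₀ := by
  induction i generalizing b with
  | zero => simpa using hb
  | succ i ih =>
    have hd : ContDiffAt ℝ ((n + i : ℕ) : WithTop ℕ∞)
        (fun p : ℝ × Q => deriv (fun s => b (s, p.2)) p.1) p₀ := by
      have h1 : ContDiffAt ℝ ((n + i : ℕ) : WithTop ℕ∞)
          (fun p : ℝ × Q => fderiv ℝ b p (1, 0)) p₀ :=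
        (hb.fderiv_right (by exact_mod_cast le_rfl)).clm_apply contDiffAt_const
      refine h1.congr_of_eventuallyEq ?_
      filter_upwards [hb.eventually (by exact_mod_cast ENat.natCast_ne_top (n + (i + 1)))] with p hp
      have h2 : HasFDerivAt b (fderiv ℝ b p) (p.1, p.2) :=
        (hp.differentiableAt (by simp)).hasFDerivAt
      have h3 : HasDerivAt (fun s : ℝ => (s, p.2)) ((1 : ℝ), (0 : Q)) p.1 :=
        (hasDerivAt_id p.1).prodMk (hasDerivAt_const _ _)
      exact (h2.comp_hasDerivAt p.1 h3).deriv
    have := ih hd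
    simp only [iteratedDeriv_succ']
    exact this

/-! ### The bifurcation equation -/

section Bifurcation

variable {f : ℝ → ℝ} (hf : ContDiff ℝ ∞ f) (v : CircleFun)

/-- The mean of `ρ (f(v + z) - f(v))`. -/
noncomputable def shift (ρ z : CircleFun) : ℝ :=
  (ρ * (CircleFun.compOp f hf.continuous (v + z) - CircleFun.compOp f hf.continuous v)).mean

/-- The equation `z' = -ε ρ (f(v + z) - f(v) - b)`, where `b` is the mean of `ρ (f(v + z) - f(v))`,
in integrated form and together with the condition that `ρ (z - s)` has mean zero. -/
noncomputable def bifurcationMap (q : (ℝ × ℝ × CircleFun) × CircleFun) : CircleFun :=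
  q.2 - q.2 0 • (1 : CircleFun) + q.1.2.1 • CircleFun.primitive (q.1.2.2 *
    (CircleFun.compOp f hf.continuous (v + q.2) - CircleFun.compOp f hf.continuous v -
      shift hf v q.1.2.2 q.2 • 1)) + (q.1.2.2 * (q.2 - q.1.1 • (1 : CircleFun))).mean • 1

lemma contDiff_shift (n : ℕ) : ContDiff ℝ n fun q : CircleFun × CircleFun => shift hf v q.1 q.2 := by
  have h1 : ContDiff ℝ n fun q : CircleFun × CircleFun =>
      CircleFun.compOp f hf.continuous (v + q.2) :=
    (CircleFun.contDiff_compOp hf n).comp (contDiff_const.add contDiff_snd)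
  exact CircleFun.mean.contDiff.comp (contDiff_fst.mul (h1.sub contDiff_const))

lemma contDiff_bifurcationMap (n : ℕ) : ContDiff ℝ n (bifurcationMap hf v) := by
  have h1 : ContDiff ℝ n fun q : (ℝ × ℝ × CircleFun) × CircleFun =>
      CircleFun.compOp f hf.continuous (v + q.2) :=
    (CircleFun.contDiff_compOp hf n).comp (contDiff_const.add contDiff_snd)
  have h2 : ContDiff ℝ n fun q : (ℝ × ℝ × CircleFun) × CircleFun => shift hf v q.1.2.2 q.2 :=
    (contDiff_shift hf v n).comp
      ((contDiff_snd.comp (contDiff_snd.comp contDiff_fst)).prodMk contDiff_snd)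
  have h3 : ContDiff ℝ n fun q : (ℝ × ℝ × CircleFun) × CircleFun => q.2 (0 : UnitAddCircle) :=
    (ContinuousMap.evalCLM ℝ (0 : UnitAddCircle) : CircleFun →L[ℝ] ℝ).contDiff.comp contDiff_snd
  have hρ : ContDiff ℝ n fun q : (ℝ × ℝ × CircleFun) × CircleFun => q.1.2.2 :=
    contDiff_snd.comp (contDiff_snd.comp contDiff_fst)
  have hε : ContDiff ℝ n fun q : (ℝ × ℝ × CircleFun) × CircleFun => q.1.2.1 :=
    contDiff_fst.comp (contDiff_snd.comp contDiff_fst)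
  have hs : ContDiff ℝ n fun q : (ℝ × ℝ × CircleFun) × CircleFun => q.1.1 :=
    contDiff_fst.comp contDiff_fst
  have h4 := CircleFun.primitive.contDiff.comp
    (hρ.mul ((h1.sub (contDiff_const (c := CircleFun.compOp f hf.continuous v))).sub (h2.smul (contDiff_const (c := (1 : CircleFun))))))
  have h5 := CircleFun.mean.contDiff.comp
    (hρ.mul (contDiff_snd.sub (hs.smul (contDiff_const (c := (1 : CircleFun))))))
  exact ((contDiff_snd.sub (h3.smul contDiff_const)).add (hε.smul h4)).add
    (h5.smul contDiff_const)

lemma bifurcationMap_const (s : ℝ) (ρ : CircleFun) :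
    bifurcationMap hf v ((s, 0, ρ), s • (1 : CircleFun)) = 0 := by
  simp [bifurcationMap]

lemma bifurcationMap_base (z : CircleFun) :
    bifurcationMap hf v ((0, 0, 1), z) = z - z 0 • (1 : CircleFun) + z.mean • 1 := by
  simp [bifurcationMap]

/-- At `ε = 0`, `ρ = 1` the map is linear in `z`, so the derivative is `w ↦ w - w(0) + mean w`, with
inverse `y ↦ y + y(0) - mean y`. -/
lemma bijective_fderiv_bifurcationMap :
    Function.Bijective fun w : CircleFun =>
      fderiv ℝ (bifurcationMap hf v) ((0, 0, 1), 0) ((0 : ℝ × ℝ × CircleFun), w) := by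
  set B : CircleFun →L[ℝ] CircleFun := ContinuousLinearMap.id ℝ CircleFun -
    (ContinuousMap.evalCLM ℝ (0 : UnitAddCircle) : CircleFun →L[ℝ] ℝ).smulRight 1 +
      CircleFun.mean.smulRight 1 with hB
  have hBapply : ∀ w, B w = w - w 0 • (1 : CircleFun) + w.mean • 1 := fun w => rfl
  have key : ∀ w : CircleFun,
      fderiv ℝ (bifurcationMap hf v) ((0, 0, 1), 0) ((0 : ℝ × ℝ × CircleFun), w) = B w := by
    have h1 : HasFDerivAt (bifurcationMap hf v) (fderiv ℝ (bifurcationMap hf v) ((0, 0, 1), 0))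
        (((0 : ℝ), (0 : ℝ), (1 : CircleFun)), (0 : CircleFun)) :=
      (((contDiff_bifurcationMap hf v 1).differentiable (by simp)) _).hasFDerivAt
    have h2 := h1.comp (0 : CircleFun)
      (hasFDerivAt_prodMk_right ((0 : ℝ), (0 : ℝ), (1 : CircleFun)) (0 : CircleFun))
    have h3 : HasFDerivAt (fun z => bifurcationMap hf v (((0 : ℝ), (0 : ℝ), (1 : CircleFun)), z)) B 0 := by
      have : (fun z => bifurcationMap hf v (((0 : ℝ), (0 : ℝ), (1 : CircleFun)), z)) = B :=
        funext fun z => (bifurcationMap_base hf v z).trans (hBapply z).symm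
      rw [this]
      exact B.hasFDerivAt
    intro w
    exact DFunLike.congr_fun (h2.unique h3) w
  simp only [key]
  constructor
  · refine (injective_iff_map_eq_zero B).2 fun w hw => ?_
    rw [hBapply] at hw
    have h0 : w 0 - w 0 * 1 + w.mean * 1 = 0 := DFunLike.congr_fun hw 0
    have hm : w.mean = 0 := by linarith
    have h1 := congrArg CircleFun.mean hw
    rw [hm, map_add, map_sub, map_smul, map_smul, hm, CircleFun.mean_one, map_zero CircleFun.mean] at h1
    have h2 : w 0 = 0 := by simpa using h1
    rw [h2, hm] at hw
    simpa using hw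
  · intro y
    refine ⟨y + (y 0 - y.mean) • (1 : CircleFun), ?_⟩
    change B _ = y
    rw [hBapply, map_add, map_smul, CircleFun.mean_one]
    ext x
    simp

/-- A weight `ρ` of mean `1` and a small time scale `1/n` for which the height of the family of
solutions of the bifurcation equation is flat to order `k`. -/
lemma exists_flat_family {k : ℕ} (hk : IsGood f k) (hv : moment f hf k v 1 = 0) :
    ∃ n : ℕ, 0 < n ∧ ∃ ρ : CircleFun, (∀ x, 0 < ρ x) ∧ ρ.mean = 1 ∧ ∃ ζ : ℝ → CircleFun,
      (∀ᶠ s in 𝓝 (0 : ℝ), bifurcationMap hf v ((s, (n : ℝ)⁻¹, ρ), ζ s) = 0) ∧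
        ∀ i, 1 ≤ i → i ≤ k → iteratedDeriv i (fun s => shift hf v ρ (ζ s)) 0 = 0 := by
  -- Order `1 + k`: after `k` derivatives in `s`, one more is needed to differentiate in `(ε, ρ)`.
  obtain ⟨ζ, hζ, hsol, huniq⟩ := exists_contDiffAt_implicit (n := 1 + k) (by omega)
    (contDiff_bifurcationMap hf v (1 + k)) (p₀ := ((0 : ℝ), (0 : ℝ), (1 : CircleFun)))
    (z₀ := (0 : CircleFun)) (by simpa using bifurcationMap_const hf v 0 1)
    (bijective_fderiv_bifurcationMap hf v)
  set b : ℝ × ℝ × CircleFun → ℝ := fun p => shift hf v p.2.2 (ζ p) with hb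
  have hbc : ContDiffAt ℝ ((1 + k : ℕ) : WithTop ℕ∞) b (0, 0, 1) :=
    (contDiff_shift hf v (1 + k)).contDiffAt.comp _
      ((contDiffAt_snd.comp _ contDiffAt_snd).prodMk hζ)
  set D : ℝ × CircleFun → (Fin k → ℝ) := fun q i =>
    iteratedDeriv (i.1 + 1) (fun s => b (s, q)) 0 with hD
  have hDc : ContDiffAt ℝ (1 : ℕ) D ((0 : ℝ), (1 : CircleFun)) := by
    refine contDiffAt_pi.2 fun i => ?_
    have h1 := contDiffAt_iteratedDeriv_fst 1 (i.1 + 1) (b := b) (p₀ := ((0 : ℝ), (0 : ℝ), (1 : CircleFun)))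
      (hbc.of_le (by exact_mod_cast (by omega : 1 + (i.1 + 1) ≤ 1 + k)))
    exact ContDiffAt.comp ((0 : ℝ), (1 : CircleFun)) (f := fun q : ℝ × CircleFun => ((0 : ℝ), q)) h1
      (contDiffAt_const.prodMk contDiffAt_id)
  -- At `ε = 0` the constant `s` solves the equation, so `ζ` equals it by local uniqueness and the
  -- height is explicit.
  have hD0 : ∀ᶠ ρ in 𝓝 (1 : CircleFun), D (0, ρ) = moment f hf k v ρ := by
    have hc : Continuous fun r : CircleFun × ℝ =>
        ((r.2, (0 : ℝ), r.1), r.2 • (1 : CircleFun)) := by fun_prop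
    have h1 : ∀ᶠ r in 𝓝 ((1 : CircleFun), (0 : ℝ)), ζ (r.2, 0, r.1) = r.2 • (1 : CircleFun) := by
      have h2 : Tendsto (fun r : CircleFun × ℝ => ((r.2, (0 : ℝ), r.1), r.2 • (1 : CircleFun)))
          (𝓝 ((1 : CircleFun), (0 : ℝ))) (𝓝 (((0 : ℝ), (0 : ℝ), (1 : CircleFun)), 0)) :=
        hc.tendsto' _ _ (by simp)
      filter_upwards [h2.eventually huniq] with r hr
      exact hr (bifurcationMap_const hf v _ _)
    filter_upwards [h1.curry_nhds] with ρ hρ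
    ext i
    have h3 : (fun s => b (s, (0 : ℝ), ρ)) =ᶠ[𝓝 0] fun s : ℝ =>
        -(ρ * CircleFun.compOp f hf.continuous v).mean +
          (ρ * CircleFun.compOp f hf.continuous (v + s • 1)).mean := by
      filter_upwards [hρ] with s hs
      change shift hf v ρ (ζ (s, 0, ρ)) = _
      rw [show ζ (s, 0, ρ) = s • (1 : CircleFun) from hs, shift, mul_sub, map_sub]
      ring
    change iteratedDeriv (i.1 + 1) (fun s => b (s, (0 : ℝ), ρ)) 0 = _
    rw [h3.iteratedDeriv_eq, iteratedDeriv_const_add (Nat.succ_pos _),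
      iteratedDeriv_mean_compOp_translate hf ρ v _
        (hf.continuous_iteratedDeriv (i.1 + 1) (by exact_mod_cast le_top))]
    beta_reduce
    rw [zero_smul, add_zero, mul_comm]
    rfl
  have hDd := hDc.hasStrictFDerivAt (by simp)
  set D' := fderiv ℝ D ((0 : ℝ), (1 : CircleFun)) with hD'
  have hD'0 : ∀ η : CircleFun, D' (0, η) = moment f hf k v η := by
    have h1 := hDd.hasFDerivAt.comp (1 : CircleFun)
      (hasFDerivAt_prodMk_right (0 : ℝ) (1 : CircleFun))
    have h2 : HasFDerivAt (D ∘ fun ρ : CircleFun => ((0 : ℝ), ρ)) (moment f hf k v) 1 :=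
      (moment f hf k v).hasFDerivAt.congr_of_eventuallyEq hD0
    exact fun η => DFunLike.congr_fun (h1.unique h2) η
  -- Recording `ε` and the mean of `ρ` beside the derivatives allows both to be prescribed. The
  -- derivative of `Φ` at `(0, 1)` is onto by `mean_moment_surjective`, so the values near `(0, 1)`
  -- fill a neighbourhood of `(0, 1, 0)`.
  set Φ : ℝ × CircleFun → ℝ × ℝ × (Fin k → ℝ) := fun q => (q.1, q.2.mean, D q) with hΦ
  have hΦd : HasStrictFDerivAt Φ ((ContinuousLinearMap.fst ℝ ℝ CircleFun).prod
      ((CircleFun.mean.comp (ContinuousLinearMap.snd ℝ ℝ CircleFun)).prod D')) (0, 1) :=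
    hasStrictFDerivAt_fst.prodMk
      ((CircleFun.mean.hasStrictFDerivAt.comp _ hasStrictFDerivAt_snd).prodMk hDd)
  have hΦsurj : LinearMap.range ((ContinuousLinearMap.fst ℝ ℝ CircleFun).prod
      ((CircleFun.mean.comp (ContinuousLinearMap.snd ℝ ℝ CircleFun)).prod D')).toLinearMap = ⊤ := by
    refine LinearMap.range_eq_top.2 ?_
    rintro ⟨τ, a, m⟩
    obtain ⟨η, hη⟩ := mean_moment_surjective hf hk hv (a, m - D' (τ, 0))
    have h1 : η.mean = a := congrArg Prod.fst hη
    have h2 : moment f hf k v η = m - D' (τ, 0) := congrArg Prod.snd hη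
    refine ⟨(τ, η), Prod.ext rfl (Prod.ext h1 ?_)⟩
    change D' (τ, η) = m
    have h3 : D' (τ, η) = D' (τ, 0) + D' (0, η) := by rw [← map_add]; simp
    rw [h3, hD'0, h2]
    abel
  have hmap := hΦd.map_nhds_eq_of_surj hΦsurj
  have hΦ0 : Φ (0, 1) = (0, 1, 0) := by
    change ((0 : ℝ), CircleFun.mean 1, D (0, 1)) = _
    rw [hD0.self_of_nhds, hv, CircleFun.mean_one]
  rw [hΦ0] at hmap
  have hgood : ∀ᶠ q in 𝓝 ((0 : ℝ), (1 : CircleFun)), (∀ x, 0 < q.2 x) ∧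
      ∀ᶠ s in 𝓝 (0 : ℝ), bifurcationMap hf v ((s, q), ζ (s, q)) = 0 := by
    have h1 : ∀ᶠ q in 𝓝 ((0 : ℝ), (1 : CircleFun)), ∀ x, 0 < q.2 x :=
      (continuous_snd.tendsto ((0 : ℝ), (1 : CircleFun))).eventually
        (Filter.mem_of_superset (Metric.ball_mem_nhds (1 : CircleFun) one_pos)
          fun ρ hρ => CircleFun.pos_of_mem_ball hρ)
    have h2 : ∀ᶠ q in 𝓝 ((0 : ℝ), (1 : CircleFun)), ∀ᶠ s in 𝓝 (0 : ℝ),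
        bifurcationMap hf v ((s, q), ζ (s, q)) = 0 := by
      have hc : Continuous fun r : (ℝ × CircleFun) × ℝ => (r.2, r.1) := by fun_prop
      have h3 : Tendsto (fun r : (ℝ × CircleFun) × ℝ => (r.2, r.1))
          (𝓝 (((0 : ℝ), (1 : CircleFun)), (0 : ℝ))) (𝓝 ((0 : ℝ), (0 : ℝ), (1 : CircleFun))) :=
        hc.tendsto' _ _ rfl
      exact (h3.eventually hsol).curry_nhds
    exact h1.and h2
  have himg : Φ '' {q | (∀ x, 0 < q.2 x) ∧
      ∀ᶠ s in 𝓝 (0 : ℝ), bifurcationMap hf v ((s, q), ζ (s, q)) = 0} ∈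
        𝓝 ((0 : ℝ), (1 : ℝ), (0 : Fin k → ℝ)) := by
    rw [← hmap]
    exact image_mem_map hgood
  -- Only `ε = 1/n` is admissible, since `t ↦ θ(nt)` must be compatible with period `1`.
  have hlim : Tendsto (fun n : ℕ => ((n : ℝ)⁻¹, (1 : ℝ), (0 : Fin k → ℝ))) atTop
      (𝓝 ((0 : ℝ), (1 : ℝ), (0 : Fin k → ℝ))) :=
    tendsto_inv_atTop_nhds_zero_nat.prodMk_nhds tendsto_const_nhds
  obtain ⟨n, ⟨⟨ε, ρ⟩, ⟨hpos, hs⟩, e⟩, hn⟩ :=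
    ((hlim.eventually himg).and (eventually_gt_atTop 0)).exists
  have e1 : ε = (n : ℝ)⁻¹ := congrArg Prod.fst e
  have e2 : ρ.mean = 1 := congrArg (fun q => q.2.1) e
  have e3 : D (ε, ρ) = 0 := congrArg (fun q => q.2.2) e
  subst e1
  refine ⟨n, hn, ρ, hpos, e2, fun s => ζ (s, (n : ℝ)⁻¹, ρ), hs, fun i hi hik => ?_⟩
  have := congrFun e3 ⟨i - 1, by omega⟩
  simp only [hD, Nat.sub_add_cancel hi] at this
  exact this

end Bifurcation

/-! ### From the bifurcation equation to the strata of the operator -/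

/-- Evaluation at `0`, where the primitive vanishes, isolates the mean condition. Because `ρ` has
mean `1`, the integrand has mean zero, so the primitive has the integrand itself as derivative. -/
lemma bifurcationMap_eq_zero {f : ℝ → ℝ} (hf : ContDiff ℝ ∞ f) (v : CircleFun) {s ε : ℝ}
    {ρ z : CircleFun} (hρ : ρ.mean = 1) (h : bifurcationMap hf v ((s, ε, ρ), z) = 0) :
    (ρ * z).mean = s ∧ ∀ t : ℝ, HasDerivAt (fun t : ℝ => z (t : UnitAddCircle))
      (-(ε * (ρ (t : UnitAddCircle) * (f (v (t : UnitAddCircle) + z (t : UnitAddCircle)) -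
        f (v (t : UnitAddCircle)) - shift hf v ρ z)))) t := by
  set g : CircleFun := ρ * (CircleFun.compOp f hf.continuous (v + z) -
    CircleFun.compOp f hf.continuous v - shift hf v ρ z • 1) with hg
  have hgm : g.mean = 0 := by
    rw [hg, mul_sub, map_sub, mul_smul_comm, mul_one, map_smul, hρ]
    exact sub_eq_zero.2 (mul_one _).symm
  have hx : ∀ x, z x - z 0 * 1 + ε * CircleFun.primitive g x +
      (ρ * (z - s • (1 : CircleFun))).mean * 1 = 0 := fun x => DFunLike.congr_fun h x
  have hm : (ρ * (z - s • (1 : CircleFun))).mean = 0 := by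
    have := hx 0
    rw [CircleFun.primitive_zero] at this
    linarith
  constructor
  · rw [mul_sub, map_sub, mul_smul_comm, mul_one, map_smul, hρ, smul_eq_mul, mul_one] at hm
    linarith
  · intro t
    have hz : (fun t : ℝ => z (t : UnitAddCircle)) =
        fun t : ℝ => z 0 - ε * CircleFun.primitive g (t : UnitAddCircle) := funext fun t => by
      have := hx t
      rw [hm] at this
      linarith
    rw [hz]
    have := ((CircleFun.hasDerivAt_primitive g t).const_mul ε).const_sub (z 0)
    rw [hgm, sub_zero] at this
    simpa [hg] using this

lemma integral_comp_mul_of_periodic {w : ℝ → ℝ} (hw : Function.Periodic w 1)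
    (hc : Continuous w) {n : ℕ} (hn : 0 < n) :
    ∫ t in (0 : ℝ)..1, w (n * t) = ∫ t in (0 : ℝ)..1, w t := by
  have hn' : (n : ℝ) ≠ 0 := by positivity
  rw [intervalIntegral.integral_comp_mul_left w hn']
  have := hw.intervalIntegral_add_zsmul_eq n 0 fun a b => hc.intervalIntegrable a b
  simp only [zero_add, natCast_zsmul, nsmul_eq_mul, mul_one] at this
  rw [mul_zero, mul_one, this, smul_eq_mul, inv_mul_cancel_left₀ hn']

/-- The function `t ↦ w(θ(nt))`, where `θ' = 1 / ρ(θ)`. -/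
lemma exists_C1_comp {ρ : CircleFun} (hpos : ∀ x, 0 < ρ x) {θ : ℝ → ℝ}
    (hθ : ∀ t, HasDerivAt θ (ρ (θ t : UnitAddCircle))⁻¹ t) (hθ1 : ∀ t, θ (t + 1) = θ t + 1)
    (hθint : ∀ g : CircleFun, ∫ t in (0 : ℝ)..1, g (θ t : UnitAddCircle) = (ρ * g).mean)
    {n : ℕ} (hn : 0 < n) {w : CircleFun} {w' : ℝ → ℝ} (hw' : Continuous w')
    (hw : ∀ t : ℝ, HasDerivAt (fun t : ℝ => w (t : UnitAddCircle)) (w' t) t) :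
    ∃ u : C1, (∀ t, u.1 t = w (θ (n * t) : UnitAddCircle)) ∧
      (∀ t, deriv u.1 t = n * w' (θ (n * t)) / ρ (θ (n * t) : UnitAddCircle)) ∧
        meanC1 u = (ρ * w).mean := by
  have hθc : ContDiff ℝ 1 θ := contDiff_reparametrization hpos hθ
  have hwc : ContDiff ℝ 1 fun t : ℝ => w (t : UnitAddCircle) := by
    rw [contDiff_one_iff_deriv]
    refine ⟨fun t => (hw t).differentiableAt, ?_⟩
    rwa [show deriv (fun t : ℝ => w (t : UnitAddCircle)) = w' from funext fun t => (hw t).deriv]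
  have hper : Function.Periodic (fun t => w (θ t : UnitAddCircle)) 1 := fun t => by
    have := w.periodic_coe (θ t)
    simp only [hθ1]
    exact this
  refine ⟨⟨fun t => w (θ (n * t) : UnitAddCircle), fun t => ?_, ?_⟩, fun t => rfl, fun t => ?_, ?_⟩
  · have := hper.nat_mul n (n * t)
    simp only [mul_one] at this
    simp only [mul_add, mul_one]
    exact this
  · exact hwc.comp (hθc.comp (contDiff_const.mul contDiff_id))
  · have h1 : HasDerivAt (fun t : ℝ => (n : ℝ) * t) n t := by
      simpa using (hasDerivAt_id t).const_mul (n : ℝ)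
    have h2 : HasDerivAt (fun t : ℝ => θ (n * t)) _ t := (hθ (n * t)).comp t h1
    have h3 := (hw (θ (n * t))).comp t h2
    refine h3.deriv.trans ?_
    rw [div_eq_mul_inv]
    ring
  · rw [← hθint w]
    exact integral_comp_mul_of_periodic hper (w.continuous_coe.comp hθc.continuous) hn

/-- For `U s = (v + ζ s)(θ(nt))` the factor `n / ρ` from the chain rule cancels `ε ρ` in the
equation for `ζ s`. Thus `U' + f(U)` equals `n v'/ρ + f(v)`, taken at `θ(nt)`, plus the constant
`shift`; only the constant depends on `s`. -/
lemma exists_flat_family_C1 {f : ℝ → ℝ} (hf : ContDiff ℝ ∞ f) {k : ℕ} (hk : IsGood f k)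
    (hne : (simpleStrataC f k).Nonempty) :
    ∃ U : ℝ → C1, ∃ β : ℝ → ℝ, (∀ᶠ s in 𝓝 (0 : ℝ),
      (∀ t, deriv (U s).1 t + f ((U s).1 t) = deriv (U 0).1 t + f ((U 0).1 t) + β s) ∧
        meanC1 (U s) = meanC1 (U 0) + s) ∧ ∀ i, 1 ≤ i → i ≤ k → iteratedDeriv i β 0 = 0 := by
  obtain ⟨u, hu⟩ := hne
  rw [mem_simpleStrataC_iff hf, ← moment_one_eq_zero_iff hf k u.2.1 u.2.2.continuous] at hu
  set v := CircleFun.ofPeriodic u.1 u.2.1 u.2.2.continuous with hv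
  have hv' : ∀ t : ℝ, HasDerivAt (fun t : ℝ => v (t : UnitAddCircle)) (deriv u.1 t) t := fun t =>
    ((u.2.2.differentiable one_ne_zero) t).hasDerivAt
  have hu' : Continuous (deriv u.1) := u.2.2.continuous_deriv le_rfl
  obtain ⟨n, hn, ρ, hpos, hρ, ζ, hζ, hflat⟩ := exists_flat_family hf v hk hu
  obtain ⟨θ, hθ, hθ1, hθint⟩ := exists_reparametrization hpos hρ
  have hn' : (n : ℝ) ≠ 0 := by positivity
  have key : ∀ s, ∃ w : C1, bifurcationMap hf v ((s, (n : ℝ)⁻¹, ρ), ζ s) = 0 →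
      (∀ t, deriv w.1 t + f (w.1 t) = n * deriv u.1 (θ (n * t)) / ρ (θ (n * t) : UnitAddCircle) +
        f (v (θ (n * t) : UnitAddCircle)) + shift hf v ρ (ζ s)) ∧
      meanC1 w = (ρ * v).mean + s := by
    intro s
    by_cases h : bifurcationMap hf v ((s, (n : ℝ)⁻¹, ρ), ζ s) = 0
    · obtain ⟨hm, hd⟩ := bifurcationMap_eq_zero hf v hρ h
      obtain ⟨w, hw, hwd, hwm⟩ := exists_C1_comp hpos hθ hθ1 hθint hn (w := v + ζ s)
        (w' := fun t => deriv u.1 t + -((n : ℝ)⁻¹ * (ρ (t : UnitAddCircle) *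
          (f (v (t : UnitAddCircle) + ζ s (t : UnitAddCircle)) -
            f (v (t : UnitAddCircle)) - shift hf v ρ (ζ s)))))
        (by
          have h1 := ρ.continuous_coe
          have h2 := v.continuous_coe
          have h3 := (ζ s).continuous_coe
          have h4 := hf.continuous
          exact hu'.add (continuous_const.mul (h1.mul (((h4.comp (h2.add h3)).sub
            (h4.comp h2)).sub continuous_const))).neg)
        (fun t => (hv' t).add (hd t))
      refine ⟨w, fun _ => ⟨fun t => ?_, ?_⟩⟩
      · have hp := (hpos (θ (n * t) : UnitAddCircle)).ne'
        rw [hwd, hw, ContinuousMap.add_apply]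
        field_simp
        ring
      · rw [hwm, mul_add, map_add, hm]
    -- An arbitrary value where the bifurcation equation fails; only `s` near `0` matters.
    · exact ⟨u, fun h' => absurd h' h⟩
  choose U hU using key
  have h0 := hU 0 hζ.self_of_nhds
  -- Subtracting the value at `s = 0` normalizes the family at `U 0` without having to know that `ζ
  -- 0 = 0`.
  refine ⟨U, fun s => -shift hf v ρ (ζ 0) + shift hf v ρ (ζ s), ?_, fun i hi hik => ?_⟩
  · filter_upwards [hζ] with s hs
    refine ⟨fun t => ?_, ?_⟩
    · rw [(hU s hs).1, h0.1]
      ring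
    · rw [(hU s hs).2, h0.2]
      ring
  · rw [iteratedDeriv_const_add hi]
    exact hflat i hi hik

lemma strataC_nonempty {f : ℝ → ℝ} (hf : ContDiff ℝ ∞ f) {k : ℕ} (hk : IsGood f k)
    (hne : (simpleStrataC f k).Nonempty) : (strataC f hf k).Nonempty := by
  obtain ⟨U, β, hU, hβ⟩ := exists_flat_family_C1 hf hk hne
  refine ⟨U 0, (mem_stratum_iff isLinearMap_meanC0 meanC0_one (injective_adaptedMap_opC f hf)
    (U := U) (β := β) ?_ k).2 hβ⟩
  filter_upwards [hU] with s hs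
  exact ⟨Subtype.ext (funext fun t => (hs.1 t).trans (congrArg _ (mul_one _).symm)), hs.2⟩

lemma strataH_nonempty {f : ℝ → ℝ} (hf : ContDiff ℝ ∞ f) {k : ℕ} (hk : IsGood f k)
    (hne : (simpleStrataC f k).Nonempty) : (strataH f hf k).Nonempty := by
  obtain ⟨U, β, hU, hβ⟩ := exists_flat_family_C1 hf hk hne
  refine ⟨(U 0).toH1, (mem_stratum_iff isLinearMap_meanH0 meanH0_one
    (injective_adaptedMap_opH f hf) (U := fun s => (U s).toH1) (β := β) ?_ k).2 hβ⟩
  filter_upwards [hU] with s hs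
  exact ⟨(toLp_eq_add_smul_oneH0_iff _ _ _).2 (Eventually.of_forall hs.1), hs.2⟩

end PeriodicODE

theorem lemma3p5 (f : ℝ → ℝ) (hf : ContDiff ℝ ∞ f) (k : ℕ) (hk : PeriodicODE.IsGood f k) :
    (((PeriodicODE.simpleStrataC f k).Nonempty ↔
        (0 : Fin k → ℝ) ∈ interior (convexHull ℝ (Set.range (PeriodicODE.gammaHat f k)))) ∧
      ((PeriodicODE.simpleStrataC f k).Nonempty → (PeriodicODE.strataC f hf k).Nonempty)) ∧
    (((PeriodicODE.simpleStrataH f k).Nonempty ↔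
        (0 : Fin k → ℝ) ∈ interior (convexHull ℝ (Set.range (PeriodicODE.gammaHat f k)))) ∧
      ((PeriodicODE.simpleStrataH f k).Nonempty → (PeriodicODE.strataH f hf k).Nonempty)) := by
  refine ⟨⟨PeriodicODE.simpleStrataC_nonempty_iff hf hk, PeriodicODE.strataC_nonempty hf hk⟩,
    PeriodicODE.simpleStrataH_nonempty_iff hf hk, fun h => PeriodicODE.strataH_nonempty hf hk ?_⟩
  exact (PeriodicODE.simpleStrataC_nonempty_iff hf hk).2
    ((PeriodicODE.simpleStrataH_nonempty_iff hf hk).1 h)
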